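/- **Conventions.** C*-algebras and *-homomorphisms are unital. For a real skew-symmetric $d\times d$ matrix $\Theta$ let $C(\mathbb T^d_\Theta)$ be the C*-algebra of operators on $\ell^2(\mathbb Z^d)$ generated by the unitaries $U_k$, $k\in\mathbb Z^d$, $(U_k\xi)(p)=e^{-\pi i\,k\cdot\Theta(p-k)}\xi(p-k)$ (equivalently, the norm completion of the rapidly decreasing sequences on $\mathbb Z^d$ with the product $(f\star g)(p)=\sum_{r+s=p}f(r)g(s)e^{-\pi i\,r\cdot\Theta s}$); its generators are $u_j=U_{e_j}$. Put $C(\mathbb T^{2N}_\theta)=C(\mathbb T^{2N}_{\theta J})$ with $J=\begin{pmatrix}0&1_N\\-1_N&0\end{pmatrix}$. A *finite noncommutative covering projection* is an injective *-homomorphism $\pi:A\to B$ with a finite group $G=G(B|A)$ of *-automorphisms of $B$ such that $B^G=\pi(A)$ and there is a finite or countable family $(a_\iota)$ in $B$ with $\sum_\iota a_\iota\,g(a_\iota^*)=1$ for $g=1$ and $=0$ for $1\ne g\in G$. A sequence $A=A_0\xrightarrow{\pi^1}A_1\xrightarrow{\pi^2}\cdots$, together with groups $G(A_m|A_k)$ of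 *-automorphisms of $A_m$ ($k<m$), is an *algebraic finite covering sequence* if all $A_n$ are separable and irreducible (not a direct sum of two nonzero rings), every composition $A_k\to A_m$ ($k<m$) is a finite noncommutative covering projection with group $G(A_m|A_k)$, and for $k<l<m$ one has $G(A_m|A_k)A_l=A_l$ and restriction to $A_l$ gives an exact sequence $1\to G(A_m|A_l)\to G(A_m|A_k)\to G(A_l|A_k)\to1$. Let $\widehat A=\varinjlim A_n$ be the C*-inductive limit. Such a sequence is *regular with covering transformation group* $\widehat G$ if $\widehat G\subset\mathrm{Aut}(\widehat A)$ is a subgroup with $\widehat A^{\widehat G}=A$ such that, for all $n$, $\widehat GA_n=A_n$ and $\widehat g\mapsto\widehat g|_{A_n}$ is a surjective homomorphism $\widehat G\to G(A_n|A)$. **Theorem.** Let $N\in\mathbb N$, $\theta>0$, let $p_1,p_2,\dots$ be integers with $p_j>1$, and put $m_0=1$, $m_n=p_1\cdots p_n$. Consider $$\mathfrak S=\Big\{C(\mathbb T^{2N}_\theta)\to C(\mathbb T^{2N}_{\theta/m_1^2})\to C(\mathbb T^{2N}_{\theta/m_2^2})\to\cdots\Big\},\qquad u_{n-1,j}\mapsto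 u_{n,j}^{p_n},$$ where, for $k<m$, the group of $C(\mathbb T^{2N}_{\theta/m_k^2})\to C(\mathbb T^{2N}_{\theta/m_m^2})$ is $\mathbb Z_r^{2N}$, $r=m_m/m_k$, acting by $\overline t\,u_{m,j}=e^{2\pi i t_j/r}u_{m,j}$. Then $\mathfrak S$ is an algebraic finite covering sequence, and it is regular with a covering transformation group $$\widehat G=G\big(\varinjlim C(\mathbb T^{2N}_{\theta/m_n^2})\,\big|\,C(\mathbb T^{2N}_\theta)\big)\cong\mathbb Z^{2N}.$$ More precisely, the isomorphism can be chosen so that $z\in\mathbb Z^{2N}$ acts by $U_k\mapsto e^{2\pi i\,z\cdot k/m_n}U_k$ on $C(\mathbb T^{2N}_{\theta/m_n^2})$; and for every $n\ge1$ there is an isomorphism $G\big(C(\mathbb T^{2N}_{\theta/m_n^2})|C(\mathbb T^{2N}_\theta)\big)\cong\mathbb Z_{m_n}^{2N}$ under which the restriction homomorphism $\widehat G\to G\big(C(\mathbb T^{2N}_{\theta/m_n^2})|C(\mathbb T^{2N}_\theta)\big)$ becomes reduction modulo $m_n$; it is surjective. -/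

import Mathlib

open Filter Topology

noncomputable section

namespace CStarTower

universe u

variable {A : ℕ → Type u} [∀ n, CStarAlgebra (A n)]

/-- The composition `A k → A m` of the maps of a sequence `A 0 → A 1 → A 2 → ⋯`, for `k ≤ m`. -/
def trans (π : ∀ n, A n →⋆ₐ[ℂ] A (n + 1)) {k m : ℕ} (h : k ≤ m) : A k →⋆ₐ[ℂ] A m :=
  Nat.leRec (motive := fun m _ => A k →⋆ₐ[ℂ] A m) (StarAlgHom.id ℂ (A k))
    (fun n _ f => (π n).comp f) h

theorem trans_self (π : ∀ n, A n →⋆ₐ[ℂ] A (n + 1)) (k : ℕ) (a : A k) :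
    trans π (le_refl k) a = a := by
  simp [trans]

theorem trans_succ (π : ∀ n, A n →⋆ₐ[ℂ] A (n + 1)) {k m : ℕ} (h : k ≤ m) (a : A k) :
    trans π (Nat.le_succ_of_le h) a = π m (trans π h a) := by
  simp only [trans]
  rw [Nat.leRec_succ _ _ h]
  rfl

theorem trans_trans (π : ∀ n, A n →⋆ₐ[ℂ] A (n + 1)) {k l m : ℕ} (h : k ≤ l) (h' : l ≤ m)
    (a : A k) : trans π h' (trans π h a) = trans π (h.trans h') a := by
  induction m, h' using Nat.le_induction with
  | base => exact trans_self π l _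
  | succ m hm ih => rw [trans_succ π hm, trans_succ π (h.trans hm), ih]

/-! ### Finite covering projections and sequences of them

All C*-algebras below are unital. For a unital algebra `B` the multiplier algebra is `B` itself and
the strict topology is the norm topology. -/

/-- An injective *-homomorphism `π : A → B` is a finite noncommutative covering projection with
covering transformation group `G`. A non-degenerate involutive action of a group on `B` is the same
as a group of *-automorphisms of `B`, so `G` is a finite subgroup of `Aut B`. -/
structure IsFiniteCovering {A B : Type u} [CStarAlgebra A] [CStarAlgebra B]
    (π : A →⋆ₐ[ℂ] B) (G : Subgroup (B ≃⋆ₐ[ℂ] B)) : Prop where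
  injective : Function.Injective π
  finite : Finite G
  fixed : {b : B | ∀ g ∈ G, g b = b} = Set.range π
  frame : ∃ (I : Type) (_ : Countable I) (a : I → B),
    HasSum (fun i => a i * star (a i)) 1 ∧
    ∀ g ∈ G, g ≠ 1 → HasSum (fun i => a i * g (star (a i))) 0

/-- A ring is irreducible if it is not a direct sum of two nontrivial rings. -/
def IsIrreducibleRing (R : Type u) [Ring R] : Prop :=
  ∀ (S T : Type u) [NonUnitalRing S] [NonUnitalRing T],
    Nonempty (R ≃+* S × T) → Subsingleton S ∨ Subsingleton T

/-- The sequence `A 0 → A 1 → ⋯` with covering transformation groups `G k m = G(A m | A k)`,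
`k < m`, is composable. -/
structure IsComposable (π : ∀ n, A n →⋆ₐ[ℂ] A (n + 1))
    (G : ∀ _ m : ℕ, Subgroup (A m ≃⋆ₐ[ℂ] A m)) : Prop where
  covering : ∀ k m (h : k < m), IsFiniteCovering (trans π h.le) (G k m)
  /-- `G(A m | A k) A l = A l` inside `A m` -/
  invariant : ∀ k l m (_ : k < l) (h : l < m), ∀ g ∈ G k m,
    g '' Set.range (trans π h.le) = Set.range (trans π h.le)
  /-- `G(A m | A l)` is contained in `G(A m | A k)`; -/
  incl : ∀ k l m, k < l → l < m → G l m ≤ G k m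
  /-- the restriction of an element of `G(A m | A k)` to `A l` belongs to `G(A l | A k)`; -/
  restrict : ∀ k l m (_ : k < l) (h : l < m), ∀ g ∈ G k m, ∃ g' ∈ G k l,
    ∀ a, g (trans π h.le a) = trans π h.le (g' a)
  /-- the kernel of the restriction is `G(A m | A l)`; -/
  exact : ∀ k l m (_ : k < l) (h : l < m), ∀ g ∈ G k m,
    (∀ a, g (trans π h.le a) = trans π h.le a) ↔ g ∈ G l m
  /-- the restriction is surjective. -/
  surj : ∀ k l m (_ : k < l) (h : l < m), ∀ g' ∈ G k l, ∃ g ∈ G k m,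
    ∀ a, g (trans π h.le a) = trans π h.le (g' a)

/-- An (algebraic) finite covering sequence: a composable sequence of irreducible separable
C*-algebras and finite noncommutative covering projections. -/
structure IsFiniteCoveringSequence (π : ∀ n, A n →⋆ₐ[ℂ] A (n + 1))
    (G : ∀ _ m : ℕ, Subgroup (A m ≃⋆ₐ[ℂ] A m)) : Prop extends IsComposable π G where
  irreducible : ∀ n, IsIrreducibleRing (A n)
  separable : ∀ n, TopologicalSpace.SeparableSpace (A n)

/-! ### The C*-inductive limit -/

/-- The sequences `(x n)` with `x n ∈ A n` that eventually satisfy `x (n + 1) = π n (x n)`. -/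
def threads (π : ∀ n, A n →⋆ₐ[ℂ] A (n + 1)) : StarSubalgebra ℂ (∀ n, A n) where
  carrier := {x | ∀ᶠ n in atTop, x (n + 1) = π n (x n)}
  mul_mem' {x y} hx hy := by
    filter_upwards [hx, hy] with n h1 h2
    simp [h1, h2]
  add_mem' {x y} hx hy := by
    filter_upwards [hx, hy] with n h1 h2
    simp [h1, h2]
  algebraMap_mem' r := by
    refine Eventually.of_forall fun n => ?_
    exact (AlgHomClass.commutes (π n) r).symm
  star_mem' {x} hx := by
    filter_upwards [hx] with n h1
    simp [h1, map_star]

/-- The *-algebra of eventually coherent sequences, with the seminorm `‖x‖ = lim ‖x n‖`. -/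
def Thread (π : ∀ n, A n →⋆ₐ[ℂ] A (n + 1)) : Type u := threads π

namespace Thread

variable (π : ∀ n, A n →⋆ₐ[ℂ] A (n + 1))

instance : Ring (Thread π) := inferInstanceAs (Ring (threads π))
instance : Algebra ℂ (Thread π) := inferInstanceAs (Algebra ℂ (threads π))
instance : StarRing (Thread π) := inferInstanceAs (StarRing (threads π))
instance : StarModule ℂ (Thread π) := inferInstanceAs (StarModule ℂ (threads π))

instance : Norm (Thread π) := ⟨fun x => limUnder atTop fun n => ‖x.1 n‖⟩

variable {π}

theorem tendsto_norm (x : Thread π) : Tendsto (fun n => ‖x.1 n‖) atTop (𝓝 ‖x‖) := by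
  obtain ⟨N, hN⟩ := eventually_atTop.1 x.2
  have hanti : Antitone fun n => ‖x.1 (n + N)‖ := by
    refine antitone_nat_of_succ_le fun n => ?_
    have h := hN (n + N) (Nat.le_add_left _ _)
    have e : n + 1 + N = n + N + 1 := by omega
    rw [e, h]
    exact NonUnitalStarAlgHom.norm_apply_le _ _
  have hlim := tendsto_atTop_ciInf hanti ⟨0, by rintro _ ⟨n, rfl⟩; exact norm_nonneg _⟩
  have h2 := (tendsto_add_atTop_iff_nat (f := fun n => ‖x.1 n‖) N).1 hlim
  exact tendsto_nhds_limUnder ⟨_, h2⟩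

instance : SeminormedRing (Thread π) :=
  RingSeminorm.toSeminormedRing
    { toFun := fun x => ‖x‖
      map_zero' := tendsto_nhds_unique (tendsto_norm (0 : Thread π)) (by
        have : (fun n => ‖(0 : Thread π).1 n‖) = fun _ => (0 : ℝ) := by
          funext n; exact norm_zero
        rw [this]; exact tendsto_const_nhds)
      add_le' := fun x y => le_of_tendsto_of_tendsto' (tendsto_norm (x + y))
        ((tendsto_norm x).add (tendsto_norm y)) fun n => norm_add_le (x.1 n) (y.1 n)
      neg' := fun x => tendsto_nhds_unique (tendsto_norm (-x)) (by
        have : (fun n => ‖(-x : Thread π).1 n‖) = fun n => ‖x.1 n‖ := by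
          funext n; exact norm_neg (x.1 n)
        rw [this]; exact tendsto_norm x)
      mul_le' := fun x y => le_of_tendsto_of_tendsto' (tendsto_norm (x * y))
        ((tendsto_norm x).mul (tendsto_norm y)) fun n => norm_mul_le (x.1 n) (y.1 n) }

theorem tendsto_norm' (x : Thread π) : Tendsto (fun n => ‖x.1 n‖) atTop (𝓝 ‖x‖) :=
  tendsto_norm x

instance : NormedAlgebra ℂ (Thread π) where
  norm_smul_le r x := le_of_tendsto_of_tendsto' (tendsto_norm' (r • x))
    ((tendsto_norm' x).const_mul ‖r‖) fun n => norm_smul_le r (x.1 n)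

instance : NormedStarGroup (Thread π) where
  norm_star_le x := le_of_tendsto_of_tendsto' (tendsto_norm' (star x)) (tendsto_norm' x)
    fun n => (norm_star (x.1 n)).le

theorem norm_mul_self_le (x : Thread π) : ‖x‖ * ‖x‖ ≤ ‖star x * x‖ :=
  le_of_tendsto_of_tendsto' ((tendsto_norm' x).mul (tendsto_norm' x))
    (tendsto_norm' (star x * x)) fun n => CStarRing.norm_mul_self_le (x.1 n)

end Thread

/-- The C*-inductive limit: the Hausdorff completion of the eventually coherent sequences. -/
def InductiveLimit (π : ∀ n, A n →⋆ₐ[ℂ] A (n + 1)) : Type u :=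
  UniformSpace.Completion (Thread π)

namespace InductiveLimit

variable (π : ∀ n, A n →⋆ₐ[ℂ] A (n + 1))

instance : NormedRing (InductiveLimit π) :=
  inferInstanceAs (NormedRing (UniformSpace.Completion (Thread π)))
instance : CompleteSpace (InductiveLimit π) :=
  inferInstanceAs (CompleteSpace (UniformSpace.Completion (Thread π)))

variable {π}

/-- The class of an eventually coherent sequence. -/
def mk (x : Thread π) : InductiveLimit π := (x : UniformSpace.Completion (Thread π))

theorem norm_mk (x : Thread π) : ‖mk x‖ = ‖x‖ := UniformSpace.Completion.norm_coe x

theorem denseRange_mk : DenseRange (mk (π := π)) := UniformSpace.Completion.denseRange_coe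

theorem continuous_mk : Continuous (mk (π := π)) := UniformSpace.Completion.continuous_coe _

instance : Algebra ℂ (InductiveLimit π) :=
  inferInstanceAs (Algebra ℂ (UniformSpace.Completion (Thread π)))

instance : NormedAlgebra ℂ (InductiveLimit π) where
  norm_smul_le r x := norm_smul_le (α := ℂ) (β := UniformSpace.Completion (Thread π)) r x

theorem mk_add (x y : Thread π) : mk (x + y) = mk x + mk y := UniformSpace.Completion.coe_add x y
theorem mk_mul (x y : Thread π) : mk (x * y) = mk x * mk y := UniformSpace.Completion.coe_mul x y
theorem mk_one : mk (1 : Thread π) = 1 := rfl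
theorem mk_smul (r : ℂ) (x : Thread π) : mk (r • x) = r • mk x :=
  UniformSpace.Completion.coe_smul r x
theorem mk_algebraMap (r : ℂ) : mk (algebraMap ℂ (Thread π) r) = algebraMap ℂ _ r := by
  rw [Algebra.algebraMap_eq_smul_one, mk_smul, mk_one, ← Algebra.algebraMap_eq_smul_one]

instance : Star (InductiveLimit π) :=
  ⟨UniformSpace.Completion.map (star : Thread π → Thread π)⟩

theorem uniformContinuous_star' : UniformContinuous (star : Thread π → Thread π) :=
  (starNormedAddGroupHom : NormedAddGroupHom (Thread π) (Thread π)).uniformContinuous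

theorem mk_star (x : Thread π) : mk (star x) = star (mk x) :=
  (UniformSpace.Completion.map_coe uniformContinuous_star' x).symm

theorem continuous_star' : Continuous (star : InductiveLimit π → InductiveLimit π) :=
  UniformSpace.Completion.continuous_map

instance : StarRing (InductiveLimit π) where
  star_involutive x := by
    refine denseRange_mk.induction_on (p := fun x => star (star x) = x) x
      (isClosed_eq (continuous_star'.comp continuous_star') continuous_id) fun a => ?_
    rw [← mk_star, ← mk_star, star_star]
  star_mul x y := by
    refine denseRange_mk.induction_on₂ (p := fun x y => star (x * y) = star y * star x)
      (isClosed_eq (continuous_star'.comp continuous_mul)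
        ((continuous_star'.comp continuous_snd).mul (continuous_star'.comp continuous_fst)))
      (fun a b => ?_) x y
    rw [← mk_mul, ← mk_star, star_mul, mk_mul, mk_star, mk_star]
  star_add x y := by
    refine denseRange_mk.induction_on₂ (p := fun x y => star (x + y) = star x + star y)
      (isClosed_eq (continuous_star'.comp continuous_add)
        ((continuous_star'.comp continuous_fst).add (continuous_star'.comp continuous_snd)))
      (fun a b => ?_) x y
    rw [← mk_add, ← mk_star, star_add, mk_add, mk_star, mk_star]

instance : CStarAlgebra (InductiveLimit π) where
  norm_mul_self_le x := by
    refine denseRange_mk.induction_on (p := fun x => ‖x‖ * ‖x‖ ≤ ‖star x * x‖) x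
      (isClosed_le (by fun_prop) ((continuous_star'.mul continuous_id).norm)) fun a => ?_
    rw [← mk_star, ← mk_mul, norm_mk, norm_mk]
    exact Thread.norm_mul_self_le a
  star_smul r x := by
    refine denseRange_mk.induction_on (p := fun x => star (r • x) = star r • star x) x
      (isClosed_eq (continuous_star'.comp (continuous_const_smul r))
        (continuous_star'.const_smul (star r))) fun a => ?_
    rw [← mk_smul, ← mk_star, star_smul, mk_smul, mk_star]

theorem mk_eq_mk {x y : Thread π} (h : ∀ᶠ n in atTop, x.1 n = y.1 n) : mk x = mk y := by
  have h0 : ‖x - y‖ = 0 := by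
    refine tendsto_nhds_unique (Thread.tendsto_norm' (x - y)) ?_
    refine tendsto_const_nhds.congr' ?_
    filter_upwards [h] with n hn
    have : (x - y).1 n = x.1 n - y.1 n := rfl
    rw [this, hn, sub_self, norm_zero]
  have h1 : ‖mk x - mk y‖ = 0 := by
    rw [← h0, ← norm_mk, sub_eq_add_neg, sub_eq_add_neg, mk_add]
    congr 2
    exact (UniformSpace.Completion.coe_neg y).symm
  exact sub_eq_zero.1 (norm_eq_zero.1 h1)

/-- The sequence `0, …, 0, a, π n a, π (n + 1) (π n a), …` of an element `a` of `A n`. -/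
def thread (π : ∀ n, A n →⋆ₐ[ℂ] A (n + 1)) (n : ℕ) (a : A n) : Thread π :=
  ⟨fun m => if h : n ≤ m then trans π h a else 0, by
    filter_upwards [eventually_ge_atTop n] with m hm
    rw [dif_pos hm, dif_pos (Nat.le_succ_of_le hm), trans_succ π hm]⟩

theorem thread_apply (n : ℕ) (a : A n) {m : ℕ} (h : n ≤ m) :
    (thread π n a).1 m = trans π h a := dif_pos h

/-- The canonical map of `A n` to the inductive limit. -/
def of (π : ∀ n, A n →⋆ₐ[ℂ] A (n + 1)) (n : ℕ) : A n →⋆ₐ[ℂ] InductiveLimit π where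
  toFun a := mk (thread π n a)
  map_one' := by
    rw [← mk_one]
    refine mk_eq_mk ?_
    filter_upwards [eventually_ge_atTop n] with m hm
    rw [thread_apply n _ hm, map_one]; rfl
  map_mul' a b := by
    rw [← mk_mul]
    refine mk_eq_mk ?_
    filter_upwards [eventually_ge_atTop n] with m hm
    have : (thread π n a * thread π n b).1 m = (thread π n a).1 m * (thread π n b).1 m := rfl
    rw [this, thread_apply n _ hm, thread_apply n _ hm, thread_apply n _ hm, map_mul]
  map_zero' := by
    have : mk (0 : Thread π) = 0 := rfl
    rw [← this]
    refine mk_eq_mk ?_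
    filter_upwards [eventually_ge_atTop n] with m hm
    rw [thread_apply n _ hm, map_zero]; rfl
  map_add' a b := by
    rw [← mk_add]
    refine mk_eq_mk ?_
    filter_upwards [eventually_ge_atTop n] with m hm
    have : (thread π n a + thread π n b).1 m = (thread π n a).1 m + (thread π n b).1 m := rfl
    rw [this, thread_apply n _ hm, thread_apply n _ hm, thread_apply n _ hm, map_add]
  commutes' r := by
    rw [← mk_algebraMap]
    refine mk_eq_mk ?_
    filter_upwards [eventually_ge_atTop n] with m hm
    rw [thread_apply n _ hm, AlgHomClass.commutes]; rfl
  map_star' a := by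
    rw [← mk_star]
    refine mk_eq_mk ?_
    filter_upwards [eventually_ge_atTop n] with m hm
    have : (star (thread π n a)).1 m = star ((thread π n a).1 m) := rfl
    rw [this, thread_apply n _ hm, thread_apply n _ hm, map_star]

theorem of_comp (n : ℕ) (a : A n) : of π (n + 1) (π n a) = of π n a := by
  refine mk_eq_mk ?_
  filter_upwards [eventually_ge_atTop (n + 1)] with m hm
  rw [thread_apply _ _ hm, thread_apply n _ ((Nat.le_succ n).trans hm),
    ← trans_trans π (Nat.le_succ n) hm, trans_succ π (le_refl n), trans_self]

theorem norm_of (hπ : ∀ n, Function.Injective (π n)) (n : ℕ) (a : A n) : ‖of π n a‖ = ‖a‖ := by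
  have e : ‖of π n a‖ = ‖thread π n a‖ := norm_mk _
  rw [e]
  refine tendsto_nhds_unique (Thread.tendsto_norm' (thread π n a)) ?_
  refine tendsto_const_nhds.congr' ?_
  filter_upwards [eventually_ge_atTop n] with m hm
  rw [thread_apply _ _ hm]
  induction m, hm using Nat.le_induction with
  | base => rw [trans_self]
  | succ m hm ih => rw [trans_succ π hm, NonUnitalStarAlgHom.norm_map (π m) (hπ m), ih]

theorem dense_iUnion_range_of : Dense (⋃ n, Set.range (of π n)) := by
  refine denseRange_mk.mono ?_
  rintro _ ⟨x, rfl⟩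
  obtain ⟨N, hN⟩ := eventually_atTop.1 x.2
  refine Set.mem_iUnion.2 ⟨N, x.1 N, ?_⟩
  refine mk_eq_mk ?_
  filter_upwards [eventually_ge_atTop N] with m hm
  rw [thread_apply _ _ hm]
  induction m, hm using Nat.le_induction with
  | base => exact trans_self π N _
  | succ m hm ih => rw [trans_succ π hm, ih, hN m hm]

end InductiveLimit

/-- The sequence is regular, with covering transformation group `Ghat`. Here `Ghat` is a group of
*-automorphisms of the inductive limit whose fixed point algebra is `A 0`; it is not required to
consist of all automorphisms that fix `A 0` pointwise. -/
structure IsRegular (π : ∀ n, A n →⋆ₐ[ℂ] A (n + 1)) (G : ∀ _ m : ℕ, Subgroup (A m ≃⋆ₐ[ℂ] A m))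
    (Ghat : Subgroup (InductiveLimit π ≃⋆ₐ[ℂ] InductiveLimit π)) : Prop where
  /-- the fixed point algebra of `Ghat` is `A 0` -/
  fixed : {a : InductiveLimit π | ∀ g ∈ Ghat, g a = a} = Set.range (InductiveLimit.of π 0)
  /-- `Ghat (A n) = A n` -/
  invariant : ∀ n, ∀ g ∈ Ghat,
    g '' Set.range (InductiveLimit.of π n) = Set.range (InductiveLimit.of π n)
  /-- restriction to `A n` maps `Ghat` to `G(A n | A 0)`; -/
  restrict : ∀ n, 0 < n → ∀ g ∈ Ghat, ∃ g' ∈ G 0 n,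
    ∀ a, g (InductiveLimit.of π n a) = InductiveLimit.of π n (g' a)
  /-- this map is surjective. -/
  surj : ∀ n, 0 < n → ∀ g' ∈ G 0 n, ∃ g ∈ Ghat,
    ∀ a, g (InductiveLimit.of π n a) = InductiveLimit.of π n (g' a)

end CStarTower

/-! ### Noncommutative tori -/

namespace NCTorus

/-- The Hilbert space `ℓ²(ℤⁿ)`. -/
abbrev L2 (ι : Type) : Type := lp (fun _ : ι → ℤ => ℂ) 2

variable {ι : Type}

theorem memlp_weightedComp (σ : (ι → ℤ) → (ι → ℤ)) (hσ : Function.Injective σ)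
    (w : (ι → ℤ) → ℂ) (hw : ∀ l, ‖w l‖ = 1) (f : L2 ι) :
    Memℓp (fun l => w l * f (σ l)) 2 := by
  have h2 : (0 : ℝ) < (2 : ENNReal).toReal := by norm_num
  refine (memℓp_gen_iff h2).2 ?_
  have := ((memℓp_gen_iff h2).1 f.2).comp_injective hσ
  refine this.congr fun l => ?_
  simp [hw]

/-- The operator `(T f)(l) = w(l) f(σ l)` on `ℓ²(ℤⁿ)`, for an injective map `σ` and `|w| = 1`. -/
def weightedComp (σ : (ι → ℤ) → (ι → ℤ)) (hσ : Function.Injective σ)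
    (w : (ι → ℤ) → ℂ) (hw : ∀ l, ‖w l‖ = 1) : L2 ι →L[ℂ] L2 ι :=
  LinearMap.mkContinuous
    { toFun := fun f => ⟨fun l => w l * f (σ l), memlp_weightedComp σ hσ w hw f⟩
      map_add' := fun f g => by
        ext l; exact mul_add _ _ _
      map_smul' := fun c f => by
        ext l; simp [mul_left_comm] } 1 (fun f => by
    have h2 : (0 : ℝ) < (2 : ENNReal).toReal := by norm_num
    rw [one_mul]
    refine lp.norm_le_of_tsum_le h2 (norm_nonneg f) ?_
    have hs := (memℓp_gen_iff h2).1 f.2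
    rw [lp.norm_rpow_eq_tsum h2 f]
    have : ∀ l, ‖w l * f (σ l)‖ ^ (2 : ENNReal).toReal = ‖f (σ l)‖ ^ (2 : ENNReal).toReal := by
      intro l; simp [hw]
    simp only [LinearMap.coe_mk, AddHom.coe_mk, this]
    exact (hs.comp_injective hσ).tsum_le_tsum_of_inj σ hσ
      (fun _ _ => by positivity) (fun _ => le_rfl) hs)

@[simp] theorem weightedComp_apply (σ : (ι → ℤ) → (ι → ℤ)) (hσ : Function.Injective σ)
    (w : (ι → ℤ) → ℂ) (hw : ∀ l, ‖w l‖ = 1) (f : L2 ι) (l : ι → ℤ) :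
    weightedComp σ hσ w hw f l = w l * f (σ l) := rfl

variable [Fintype ι]

/-- The real number `k · Θ s`. -/
def pairing (Θ : Matrix ι ι ℝ) (k s : ι → ℤ) : ℝ :=
  (fun a => (k a : ℝ)) ⬝ᵥ Θ.mulVec (fun b => (s b : ℝ))

theorem pairing_add_left (Θ : Matrix ι ι ℝ) (k k' s : ι → ℤ) :
    pairing Θ (k + k') s = pairing Θ k s + pairing Θ k' s := by
  rw [pairing, pairing, pairing, ← add_dotProduct]
  congr 1; funext a; simp

theorem pairing_add_right (Θ : Matrix ι ι ℝ) (k s s' : ι → ℤ) :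
    pairing Θ k (s + s') = pairing Θ k s + pairing Θ k s' := by
  rw [pairing, pairing, pairing, ← dotProduct_add, ← Matrix.mulVec_add]
  congr 2; funext a; simp

theorem pairing_smul_left (Θ : Matrix ι ι ℝ) (c : ℤ) (k s : ι → ℤ) :
    pairing Θ (c • k) s = c * pairing Θ k s := by
  rw [pairing, pairing, ← smul_eq_mul (c : ℝ), ← smul_dotProduct]
  congr 1; funext a; simp

theorem pairing_smul_right (Θ : Matrix ι ι ℝ) (c : ℤ) (k s : ι → ℤ) :
    pairing Θ k (c • s) = c * pairing Θ k s := by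
  rw [pairing, pairing, ← smul_eq_mul (c : ℝ), ← dotProduct_smul, ← Matrix.mulVec_smul]
  congr 2; funext a; simp

theorem pairing_sub_right (Θ : Matrix ι ι ℝ) (k s s' : ι → ℤ) :
    pairing Θ k (s - s') = pairing Θ k s - pairing Θ k s' := by
  have := pairing_add_right Θ k (s - s') s'
  rw [sub_add_cancel] at this
  linarith

theorem pairing_sub_left (Θ : Matrix ι ι ℝ) (k k' s : ι → ℤ) :
    pairing Θ (k - k') s = pairing Θ k s - pairing Θ k' s := by
  have := pairing_add_left Θ (k - k') k' s
  rw [sub_add_cancel] at this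
  linarith

theorem pairing_smul (Θ : Matrix ι ι ℝ) (c : ℝ) (k s : ι → ℤ) :
    pairing (c • Θ) k s = c * pairing Θ k s := by
  simp [pairing, Matrix.smul_mulVec, dotProduct_smul]

/-- `e(x) = exp(π i x)`. -/
def phase (x : ℝ) : ℂ := Complex.exp ((Real.pi * x : ℝ) * Complex.I)

theorem norm_phase (x : ℝ) : ‖phase x‖ = 1 := Complex.norm_exp_ofReal_mul_I _

theorem phase_add (x y : ℝ) : phase (x + y) = phase x * phase y := by
  rw [phase, phase, phase, ← Complex.exp_add]
  congr 1; push_cast; ring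

theorem phase_zero : phase 0 = 1 := by simp [phase]

/-- Left multiplication by `U_k` for the product
`(f ⋆ g)(p) = ∑_{r + s = p} f(r) g(s) exp(-π i r · Θ s)`:
`(U_k g)(p) = exp(-π i k · Θ (p - k)) g(p - k)`. -/
def U (Θ : Matrix ι ι ℝ) (k : ι → ℤ) : L2 ι →L[ℂ] L2 ι :=
  weightedComp (fun p => p - k) (sub_left_injective)
    (fun p => phase (-pairing Θ k (p - k))) (fun _ => norm_phase _)

theorem U_apply (Θ : Matrix ι ι ℝ) (k : ι → ℤ) (f : L2 ι) (p : ι → ℤ) :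
    U Θ k f p = phase (-pairing Θ k (p - k)) * f (p - k) := rfl

theorem U_zero (Θ : Matrix ι ι ℝ) : U Θ 0 = 1 := by
  ext f p
  have : pairing Θ 0 p = 0 := by
    have := pairing_smul_left Θ 0 0 p
    simpa using this
  simp [U_apply, this, phase_zero]

theorem U_mul (Θ : Matrix ι ι ℝ) (k l : ι → ℤ) :
    U Θ k * U Θ l = phase (-pairing Θ k l) • U Θ (k + l) := by
  ext f p
  change U Θ k (U Θ l f) p = phase (-pairing Θ k l) * U Θ (k + l) f p
  rw [U_apply, U_apply, U_apply, ← mul_assoc, ← mul_assoc, ← phase_add, ← phase_add,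
    show p - (k + l) = p - k - l by abel]
  congr 2
  simp only [pairing_sub_right, pairing_add_left]
  ring

/-- The noncommutative torus `C(𝕋ⁿ_Θ)`: the C*-algebra of operators on `ℓ²(ℤⁿ)`, the GNS space of
the canonical trace, generated by the `U_k`. It is the norm closure of the operators
`∑ a_k U_k` with `a` rapidly decreasing (or finitely supported). -/
def torusSubalgebra (Θ : Matrix ι ι ℝ) : StarSubalgebra ℂ (L2 ι →L[ℂ] L2 ι) :=
  (StarAlgebra.adjoin ℂ (Set.range (U Θ))).topologicalClosure

/-- The noncommutative torus `C(𝕋ⁿ_Θ)`. -/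
abbrev Torus (Θ : Matrix ι ι ℝ) : Type := torusSubalgebra Θ

instance (Θ : Matrix ι ι ℝ) : CStarAlgebra (Torus Θ) :=
  StarSubalgebra.cstarAlgebra (torusSubalgebra Θ)
    (h_closed := StarSubalgebra.isClosed_topologicalClosure _)

/-- `U_k` as an element of `C(𝕋ⁿ_Θ)`. -/
def unit (Θ : Matrix ι ι ℝ) (k : ι → ℤ) : Torus Θ :=
  ⟨U Θ k, StarSubalgebra.le_topologicalClosure _ (StarAlgebra.subset_adjoin ℂ _ ⟨k, rfl⟩)⟩

/-! #### The *-homomorphism `C(𝕋ⁿ_Θ) → C(𝕋ⁿ_Θ')`, `u_j ↦ u_j ^ p`, where `Θ = p² Θ'` -/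

section Cover

variable [DecidableEq ι] (Θ Θ' : Matrix ι ι ℝ) (p : ℕ) [NeZero p]

/-- The map `l ↦ c + p l`. -/
def embed (c : ι → Fin p) (l : ι → ℤ) : ι → ℤ := fun a => ((c a : ℕ) : ℤ) + p * l a

/-- Every element of `ℤⁿ` is `c + p l` for exactly one `(c, l)`. -/
def embedEquiv : (ι → Fin p) × (ι → ℤ) ≃ (ι → ℤ) :=
  (Equiv.arrowProdEquivProdArrow ι (fun _ => Fin p) (fun _ => ℤ)).symm.trans
    (Equiv.piCongrRight fun _ => (Equiv.prodComm _ _).trans (Int.divModEquiv p).symm)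

theorem embedEquiv_apply (x : (ι → Fin p) × (ι → ℤ)) : embedEquiv p x = embed p x.1 x.2 := by
  funext a
  simp [embedEquiv, embed, Int.divModEquiv, add_comm, mul_comm]

theorem embed_injective (c : ι → Fin p) : Function.Injective (embed p c) := by
  intro l l' h
  have := (embedEquiv (ι := ι) p).injective (a₁ := (c, l)) (a₂ := (c, l'))
    (by rw [embedEquiv_apply, embedEquiv_apply]; exact h)
  exact (Prod.ext_iff.1 this).2

/-- The coisometry `D_c` of `ℓ²(ℤⁿ)` onto `ℓ²(c + p ℤⁿ) ≅ ℓ²(ℤⁿ)`, with a phase. -/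
def slice (c : ι → Fin p) : L2 ι →L[ℂ] L2 ι :=
  weightedComp (embed p c) (embed_injective p c)
    (fun l => phase (p * pairing Θ' l (fun a => ((c a : ℕ) : ℤ)))) (fun _ => norm_phase _)

theorem slice_apply (c : ι → Fin p) (f : L2 ι) (l : ι → ℤ) :
    slice Θ' p c f l = phase (p * pairing Θ' l (fun a => ((c a : ℕ) : ℤ))) * f (embed p c l) := rfl

open ContinuousLinearMap in
theorem slice_adjoint (c c' : ι → Fin p) :
    slice Θ' p c * star (slice Θ' p c') = if c = c' then 1 else 0 := by
  ext f l
  change slice Θ' p c (adjoint (slice Θ' p c') f) l = _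
  rw [slice_apply]
  have key : ∀ m, (adjoint (slice Θ' p c') f) m
      = inner ℂ (slice Θ' p c' (lp.single 2 m (1 : ℂ))) f := by
    intro m
    rw [← adjoint_inner_right, lp.inner_single_left]
    simp
  have hs : slice Θ' p c' (lp.single 2 (embed p c l) (1 : ℂ))
      = if c = c' then
          phase (p * pairing Θ' l (fun a => ((c a : ℕ) : ℤ))) • lp.single 2 l (1 : ℂ) else 0 := by
    ext l'
    rw [slice_apply]
    by_cases h : embed p c' l' = embed p c l
    · have h' := (embedEquiv (ι := ι) p).injective (a₁ := (c', l')) (a₂ := (c, l))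
        (by rw [embedEquiv_apply, embedEquiv_apply]; exact h)
      obtain ⟨rfl, rfl⟩ := Prod.ext_iff.1 h'
      simp
    · rw [lp.single_apply_ne _ _ _ h]
      split_ifs with hc
      · subst hc
        have : l' ≠ l := fun e => h (by rw [e])
        change _ = phase _ * (lp.single 2 l (1 : ℂ) : L2 ι) l'
        rw [lp.single_apply_ne _ _ _ this, mul_zero, mul_zero]
      · simp
  rw [key, hs]
  split_ifs with hc
  · rw [inner_smul_left, lp.inner_single_left]
    have : phase (p * pairing Θ' l (fun a => ((c a : ℕ) : ℤ)))
        * (starRingEnd ℂ) (phase (p * pairing Θ' l (fun a => ((c a : ℕ) : ℤ)))) = 1 := by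
      rw [Complex.mul_conj, Complex.normSq_eq_norm_sq, norm_phase]; simp
    rw [← mul_assoc, this]
    simp
  · simp

open ContinuousLinearMap in
theorem sum_slice : ∑ c : ι → Fin p, star (slice Θ' p c) * slice Θ' p c = 1 := by
  refine ContinuousLinearMap.ext fun f => ext_inner_left ℂ fun g => ?_
  rw [sum_apply, inner_sum]
  have h1 : ∀ c : ι → Fin p, inner ℂ g ((star (slice Θ' p c) * slice Θ' p c) f)
      = ∑' l, inner ℂ (g (embed p c l)) (f (embed p c l)) := by
    intro c
    change inner ℂ g (adjoint (slice Θ' p c) (slice Θ' p c f)) = _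
    rw [adjoint_inner_right, lp.inner_eq_tsum]
    refine tsum_congr fun l => ?_
    rw [slice_apply, slice_apply, RCLike.inner_apply', RCLike.inner_apply', map_mul]
    have : (starRingEnd ℂ) (phase (p * pairing Θ' l (fun a => ((c a : ℕ) : ℤ))))
        * phase (p * pairing Θ' l (fun a => ((c a : ℕ) : ℤ))) = 1 := by
      rw [mul_comm, Complex.mul_conj, Complex.normSq_eq_norm_sq, norm_phase]; simp
    linear_combination ((starRingEnd ℂ) (g (embed p c l)) * f (embed p c l)) * this
  have hsum := (lp.summable_inner (𝕜 := ℂ) g f)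
  have hsum' := (embedEquiv (ι := ι) p).summable_iff.2 hsum
  rw [Finset.sum_congr rfl fun c _ => h1 c]
  change _ = inner ℂ g f
  have h2 : ∑' x, inner ℂ (g (embedEquiv p x)) (f (embedEquiv p x)) =
      ∑ c : ι → Fin p, ∑' l, inner ℂ (g (embed p c l)) (f (embed p c l)) := by
    refine (Summable.tsum_prod hsum').trans ?_
    rw [tsum_fintype]
    simp only [Function.comp_apply, embedEquiv_apply]
  rw [lp.inner_eq_tsum, ← h2]
  exact (embedEquiv (ι := ι) p).tsum_eq fun m => inner ℂ (g m) (f m)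

variable {Θ Θ'} in
theorem slice_U (h : Θ = ((p : ℝ) ^ 2) • Θ') (c : ι → Fin p) (k : ι → ℤ) :
    slice Θ' p c * U Θ' ((p : ℤ) • k) = U Θ k * slice Θ' p c := by
  ext f l
  change slice Θ' p c (U Θ' ((p : ℤ) • k) f) l = U Θ k (slice Θ' p c f) l
  have e : embed p c l - (p : ℤ) • k = embed p c (l - k) := by
    funext a; simp [embed]; ring
  have e' : embed p c (l - k) = (fun a => ((c a : ℕ) : ℤ)) + (p : ℤ) • (l - k) := by
    funext a; simp [embed]
  rw [slice_apply, U_apply, U_apply, slice_apply, e, ← mul_assoc, ← mul_assoc, ← phase_add,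
    ← phase_add]
  congr 2
  rw [e', h, pairing_smul]
  simp only [pairing_add_right, pairing_smul_left, pairing_smul_right, pairing_sub_left]
  push_cast
  ring

/-- `T ↦ ⊕_c T` along `ℓ²(ℤⁿ) = ⊕_c ℓ²(c + p ℤⁿ)`. -/
def amplify : (L2 ι →L[ℂ] L2 ι) →⋆ₐ[ℂ] (L2 ι →L[ℂ] L2 ι) where
  toFun T := ∑ c : ι → Fin p, star (slice Θ' p c) * T * slice Θ' p c
  map_one' := by simpa using sum_slice Θ' p
  map_zero' := by simp
  map_add' S T := by simp [mul_add, add_mul, Finset.sum_add_distrib]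
  map_mul' S T := by
    rw [Finset.sum_mul_sum]
    refine Finset.sum_congr rfl fun c _ => ?_
    rw [Finset.sum_eq_single c]
    · have := slice_adjoint Θ' p c c
      rw [if_pos rfl] at this
      calc star (slice Θ' p c) * (S * T) * slice Θ' p c
          = star (slice Θ' p c) * S * 1 * T * slice Θ' p c := by simp only [mul_assoc, one_mul]
        _ = _ := by rw [← this]; simp only [mul_assoc]
    · intro c' _ hc
      have := slice_adjoint Θ' p c c'
      rw [if_neg (Ne.symm hc)] at this
      calc star (slice Θ' p c) * S * slice Θ' p c * (star (slice Θ' p c') * T * slice Θ' p c')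
          = star (slice Θ' p c) * S * (slice Θ' p c * star (slice Θ' p c')) * T * slice Θ' p c' := by
            simp only [mul_assoc]
        _ = 0 := by rw [this]; simp
    · simp
  commutes' r := by
    simp only [Algebra.algebraMap_eq_smul_one, mul_smul_comm, smul_mul_assoc, mul_one,
      ← Finset.smul_sum, sum_slice]
  map_star' T := by
    rw [star_sum]
    refine Finset.sum_congr rfl fun c _ => ?_
    simp only [star_mul, star_star, mul_assoc]

variable {Θ Θ'} in
theorem amplify_U (h : Θ = ((p : ℝ) ^ 2) • Θ') (k : ι → ℤ) :
    amplify Θ' p (U Θ k) = U Θ' ((p : ℤ) • k) := by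
  change ∑ c : ι → Fin p, star (slice Θ' p c) * U Θ k * slice Θ' p c = _
  simp only [mul_assoc, ← slice_U p h]
  simp only [← mul_assoc]
  rw [← Finset.sum_mul, sum_slice, one_mul]

variable {Θ Θ'} in
theorem amplify_mem (h : Θ = ((p : ℝ) ^ 2) • Θ') (T : L2 ι →L[ℂ] L2 ι)
    (hT : T ∈ torusSubalgebra Θ) : amplify Θ' p T ∈ torusSubalgebra Θ' := by
  have hc : Continuous (amplify Θ' p) := map_continuous (amplify Θ' p)
  have h1 : torusSubalgebra Θ ≤ (torusSubalgebra Θ').comap (amplify Θ' p) := by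
    refine StarSubalgebra.topologicalClosure_minimal ?_
      ((StarSubalgebra.isClosed_topologicalClosure _).preimage hc)
    refine StarAlgebra.adjoin_le ?_
    rintro _ ⟨k, rfl⟩
    change amplify Θ' p (U Θ k) ∈ torusSubalgebra Θ'
    rw [amplify_U p h]
    exact (unit Θ' _).2
  exact h1 hT

variable {Θ Θ'} in
/-- The *-homomorphism `C(𝕋ⁿ_Θ) → C(𝕋ⁿ_Θ')` with `U_k ↦ U_{p k}`, where `Θ = p² Θ'`. -/
def cover (h : Θ = ((p : ℝ) ^ 2) • Θ') : Torus Θ →⋆ₐ[ℂ] Torus Θ' :=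
  ((amplify Θ' p).comp (torusSubalgebra Θ).subtype).codRestrict (torusSubalgebra Θ')
    fun T => amplify_mem p h T.1 T.2

variable {Θ Θ'} in
theorem cover_unit (h : Θ = ((p : ℝ) ^ 2) • Θ') (k : ι → ℤ) :
    cover p h (unit Θ k) = unit Θ' ((p : ℤ) • k) :=
  Subtype.ext (amplify_U p h k)

end Cover

/-- The generators `u_j` of `C(𝕋ⁿ_Θ)`. -/
def gen [DecidableEq ι] (Θ : Matrix ι ι ℝ) (j : ι) : Torus Θ := unit Θ (Pi.single j 1)

theorem gen_pow [DecidableEq ι] (Θ : Matrix ι ι ℝ) (j : ι) (hj : Θ j j = 0) (m : ℕ) :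
    gen Θ j ^ m = unit Θ ((m : ℤ) • Pi.single j 1) := by
  have h0 : pairing Θ (Pi.single j 1) (Pi.single j 1) = 0 := by
    have : (fun a => (((Pi.single j 1 : ι → ℤ) a : ℤ) : ℝ)) = Pi.single j 1 := by
      funext a; by_cases h : a = j
      · subst h; simp
      · simp [h]
    rw [pairing, this, Matrix.mulVec_single_one, single_one_dotProduct]
    exact hj
  induction m with
  | zero => 
    refine Subtype.ext ?_
    simp [unit, U_zero]
  | succ m ih =>
    rw [pow_succ, ih]
    refine Subtype.ext ?_
    change U Θ _ * U Θ _ = U Θ _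
    rw [U_mul, pairing_smul_left, h0, mul_zero, neg_zero, phase_zero, one_smul]
    congr 1
    push_cast
    rw [add_smul, one_smul]

theorem cover_gen [DecidableEq ι] {Θ Θ' : Matrix ι ι ℝ} (p : ℕ) [NeZero p]
    (h : Θ = ((p : ℝ) ^ 2) • Θ') (j : ι) (hj : Θ' j j = 0) :
    cover p h (gen Θ j) = gen Θ' j ^ p := by
  rw [gen_pow Θ' j hj]
  exact cover_unit p h _

/-- The group of the *-automorphisms `U_k ↦ exp(2π i t · k / r) U_k` of `C(𝕋ⁿ_Θ)` with `t ∈ ℤⁿ`,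
that is, the image of the action `u_j ↦ exp(2π i t_j / r) u_j` of `(ℤ / r)ⁿ`. -/
def rotations (Θ : Matrix ι ι ℝ) (r : ℕ) : Subgroup (Torus Θ ≃⋆ₐ[ℂ] Torus Θ) where
  carrier := {g | ∃ t : ι → ℤ, ∀ k : ι → ℤ,
    g (unit Θ k) = phase (2 * ((∑ j, t j * k j : ℤ) : ℝ) / r) • unit Θ k}
  one_mem' := ⟨0, fun k => by simp [phase_zero]⟩
  mul_mem' := by
    rintro g g' ⟨t, ht⟩ ⟨t', ht'⟩
    refine ⟨t + t', fun k => ?_⟩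
    rw [StarAlgEquiv.mul_apply, ht', map_smul, ht, smul_smul, ← phase_add]
    congr 2
    simp only [Pi.add_apply, add_mul, Finset.sum_add_distrib]
    push_cast
    ring
  inv_mem' := by
    rintro g ⟨t, ht⟩
    refine ⟨-t, fun k => ?_⟩
    rw [StarAlgEquiv.aut_inv, StarAlgEquiv.symm_apply_eq, map_smul, ht, smul_smul, ← phase_add]
    simp only [Pi.neg_apply, neg_mul, Finset.sum_neg_distrib]
    push_cast
    rw [show 2 * (-∑ j, (t j : ℝ) * k j) / r + 2 * (∑ j, (t j : ℝ) * k j) / r = 0 by ring,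
      phase_zero, one_smul]

/-! #### The tower `C(𝕋²ᴺ_θ) → C(𝕋²ᴺ_{θ/m₁²}) → C(𝕋²ᴺ_{θ/m₂²}) → ⋯` -/

/-- `m_n`, the product of the first `n` terms of the sequence `p`. -/
def mult (p : ℕ → ℕ) (n : ℕ) : ℕ := ∏ j ∈ Finset.range n, p j

/-- The matrix `Θ = θ J`, `J = (0, 1; -1, 0)`, of size `2N`. -/
def symplectic (N : ℕ) (θ : ℝ) : Matrix (Fin N ⊕ Fin N) (Fin N ⊕ Fin N) ℝ :=
  θ • Matrix.fromBlocks 0 1 (-1) 0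

/-- The matrix `(θ / m_n²) J`. -/
def towerMatrix (N : ℕ) (θ : ℝ) (p : ℕ → ℕ) (n : ℕ) :
    Matrix (Fin N ⊕ Fin N) (Fin N ⊕ Fin N) ℝ :=
  symplectic N (θ / (mult p n : ℝ) ^ 2)

/-- The algebra `C(𝕋²ᴺ_{θ/m_n²})`. -/
abbrev towerAlgebra (N : ℕ) (θ : ℝ) (p : ℕ → ℕ) (n : ℕ) : Type := Torus (towerMatrix N θ p n)

theorem towerMatrix_succ (N : ℕ) (θ : ℝ) (p : ℕ → ℕ) (hp : ∀ j, 1 < p j) (n : ℕ) :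
    towerMatrix N θ p n = ((p n : ℝ) ^ 2) • towerMatrix N θ p (n + 1) := by
  have h : (p n : ℝ) ≠ 0 := by exact_mod_cast (zero_lt_one.trans (hp n)).ne'
  rw [towerMatrix, towerMatrix, symplectic, symplectic, smul_smul]
  congr 1
  rw [mult, mult, Finset.prod_range_succ]
  push_cast
  rw [mul_pow]
  field_simp

/-- The *-homomorphism `C(𝕋²ᴺ_{θ/m_n²}) → C(𝕋²ᴺ_{θ/m_{n+1}²})`, `u_{n,j} ↦ u_{n+1,j} ^ {p_n}`. -/
def towerMap (N : ℕ) (θ : ℝ) (p : ℕ → ℕ) (hp : ∀ j, 1 < p j) (n : ℕ) :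
    towerAlgebra N θ p n →⋆ₐ[ℂ] towerAlgebra N θ p (n + 1) :=
  haveI : NeZero (p n) := ⟨(zero_lt_one.trans (hp n)).ne'⟩
  cover (p n) (towerMatrix_succ N θ p hp n)

theorem towerMap_gen (N : ℕ) (θ : ℝ) (p : ℕ → ℕ) (hp : ∀ j, 1 < p j) (n : ℕ)
    (j : Fin N ⊕ Fin N) :
    towerMap N θ p hp n (gen (towerMatrix N θ p n) j) =
      gen (towerMatrix N θ p (n + 1)) j ^ p n := by
  have : NeZero (p n) := ⟨(zero_lt_one.trans (hp n)).ne'⟩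
  refine cover_gen (p n) (towerMatrix_succ N θ p hp n) j ?_
  rcases j with j | j <;> simp [towerMatrix, symplectic]

/-- The covering transformation group `≅ ℤ_r²ᴺ` of `C(𝕋²ᴺ_{θ/m_k²}) → C(𝕋²ᴺ_{θ/m_m²})`,
where `r = m_m / m_k = p_k ⋯ p_{m-1}`. -/
def towerGroup (N : ℕ) (θ : ℝ) (p : ℕ → ℕ) (k m : ℕ) :
    Subgroup (towerAlgebra N θ p m ≃⋆ₐ[ℂ] towerAlgebra N θ p m) :=
  rotations (towerMatrix N θ p m) (∏ j ∈ Finset.Ico k m, p j)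

end NCTorus

end

/-! Everything is governed by the gauge action of `ℝⁿ`: `s` acts by `U_k ↦ exp(2π i s · k) U_k`. It
is implemented by diagonal unitaries, its kernel is `ℤⁿ` (`gauge_eq_one_iff`), and the rotation
group of order parameter `r` is the image of `(1/r)ℤⁿ`, hence `(ℤ/r)ⁿ`. Since the `U_k` span a dense
subspace (`dense_span_unit`), identities between continuous linear maps need only be checked on
them.

Averaging over the rotations by multiples of `1/r` keeps `U_k` for `k ∈ rℤⁿ` and kills the other
`U_k`, by orthogonality of characters. So the fixed algebra is the range of the map `U_k ↦ U_{rk}`.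
The same orthogonality makes the normalised `U_c`, with `c` running over residues mod `r`, a frame;
this gives the covering property (`isFiniteCovering_of_unit`).

Irreducibility is a connectedness argument. A central idempotent has a locally constant, hence
constant, orbit under each line of the gauge group, and only scalars are gauge invariant; so central
idempotents are `0` or `1`.

A map `U_k ↦ U_{rk}` intertwines the gauge parameter `rs` below with `s` above
(`gauge_apply_of_unit`). Exactness of the restriction sequences thus becomes arithmetic of
fractions. Also, the parameters `z/m_n` on the levels `A_n` are compatible for fixed `z ∈ ℤ²ᴺ`,
which defines the action on the limit. It is faithful because `m_n → ∞`. Its fixed algebra is `A_0`: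
a fixed element is approximated in some `A_n`, and averaging over finitely many group elements moves
the approximant into `A_0` without increasing the error (`limitGauge_fixed`). -/

noncomputable section

/-! ### Products, adjoints and density of the span of the `U_k` -/

namespace NCTorus

variable {ι : Type}

/-- The adjoint of a weighted composition operator along a bijection. -/
theorem star_weightedComp (σ : (ι → ℤ) ≃ (ι → ℤ)) (w : (ι → ℤ) → ℂ) (hw : ∀ l, ‖w l‖ = 1) :
    star (weightedComp σ σ.injective w hw) =
      weightedComp σ.symm σ.symm.injective (fun l => star (w (σ.symm l)))
        (fun l => by rw [norm_star, hw]) := by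
  refine ContinuousLinearMap.ext fun g => ext_inner_left ℂ fun f => ?_
  rw [ContinuousLinearMap.star_eq_adjoint, ContinuousLinearMap.adjoint_inner_right,
    lp.inner_eq_tsum, lp.inner_eq_tsum, ← σ.symm.tsum_eq]
  refine tsum_congr fun l => ?_
  simp only [weightedComp_apply, RCLike.inner_apply', map_mul, Equiv.apply_symm_apply]
  simp only [starRingEnd_apply]
  ring

variable [Fintype ι]

theorem star_phase (x : ℝ) : star (phase x) = phase (-x) := by
  simp [phase, ← Complex.exp_conj]

theorem star_U (Θ : Matrix ι ι ℝ) (k : ι → ℤ) :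
    star (U Θ k) = phase (-pairing Θ k k) • U Θ (-k) := by
  refine (star_weightedComp (Equiv.subRight k) _ fun _ => norm_phase _).trans ?_
  ext f l
  change star (phase (-pairing Θ k (l + k - k))) * f (l + k) =
    phase (-pairing Θ k k) * (phase (-pairing Θ (-k) (l - -k)) * f (l - -k))
  have h : pairing Θ (-k) (l + k) = - pairing Θ k (l + k) := by
    have := pairing_smul_left Θ (-1) k (l + k)
    simpa using this
  rw [star_phase, ← mul_assoc, ← phase_add, sub_neg_eq_add, h, pairing_add_right,
    add_sub_cancel_right]
  congr 2
  ring

theorem unit_mul (Θ : Matrix ι ι ℝ) (k l : ι → ℤ) :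
    unit Θ k * unit Θ l = phase (-pairing Θ k l) • unit Θ (k + l) :=
  Subtype.ext (U_mul Θ k l)

theorem star_unit (Θ : Matrix ι ι ℝ) (k : ι → ℤ) :
    star (unit Θ k) = phase (-pairing Θ k k) • unit Θ (-k) :=
  Subtype.ext (star_U Θ k)

theorem unit_zero (Θ : Matrix ι ι ℝ) : unit Θ 0 = 1 := Subtype.ext (U_zero Θ)

theorem unit_mul_star (Θ : Matrix ι ι ℝ) (k : ι → ℤ) : unit Θ k * star (unit Θ k) = 1 := by
  have h : pairing Θ k (-k) = - pairing Θ k k := by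
    have := pairing_smul_right Θ (-1) k k
    simpa using this
  rw [star_unit, mul_smul_comm, unit_mul, smul_smul, ← phase_add, h, neg_neg,
    neg_add_cancel, phase_zero, one_smul, add_neg_cancel, unit_zero]

instance (Θ : Matrix ι ι ℝ) : Nontrivial (Torus Θ) := by
  refine ⟨⟨1, 0, fun h => ?_⟩⟩
  have h1 : (1 : L2 ι →L[ℂ] L2 ι) = 0 := congrArg Subtype.val h
  have h2 : (lp.single 2 (0 : ι → ℤ) (1 : ℂ) : L2 ι) = 0 := by
    classical
    simpa using congrArg (fun T : L2 ι →L[ℂ] L2 ι => T (lp.single 2 (0 : ι → ℤ) (1 : ℂ))) h1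
  have h3 := congrArg (fun f : L2 ι => f 0) h2
  simp at h3

theorem unit_ne_zero (Θ : Matrix ι ι ℝ) (k : ι → ℤ) : unit Θ k ≠ 0 := by
  intro h
  have := unit_mul_star Θ k
  rw [h, zero_mul] at this
  exact zero_ne_one this

/-- Products and adjoints of the `U_k` are again scalar multiples of some `U_l`, so their linear
span is already a unital *-algebra. This reduces density arguments to linear combinations. -/
theorem mem_span_range_U (Θ : Matrix ι ι ℝ) {x : L2 ι →L[ℂ] L2 ι}
    (hx : x ∈ StarAlgebra.adjoin ℂ (Set.range (U Θ))) : x ∈ Submodule.span ℂ (Set.range (U Θ)) := by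
  induction hx using StarAlgebra.adjoin_induction with
  | mem x hx => exact Submodule.subset_span hx
  | algebraMap r =>
    rw [Algebra.algebraMap_eq_smul_one, ← U_zero Θ]
    exact Submodule.smul_mem _ _ (Submodule.subset_span ⟨0, rfl⟩)
  | add x y _ _ hx hy => exact Submodule.add_mem _ hx hy
  | mul x y hx' hy' hx hy =>
    clear hx' hy'
    induction hx, hy using Submodule.span_induction₂ with
    | mem_mem x y hx hy =>
      obtain ⟨k, rfl⟩ := hx
      obtain ⟨l, rfl⟩ := hy
      rw [U_mul]
      exact Submodule.smul_mem _ _ (Submodule.subset_span ⟨_, rfl⟩)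
    | zero_left y => simp
    | zero_right x => simp
    | add_left x y z _ _ _ h1 h2 => rw [add_mul]; exact Submodule.add_mem _ h1 h2
    | add_right x y z _ _ _ h1 h2 => rw [mul_add]; exact Submodule.add_mem _ h1 h2
    | smul_left r x y _ _ h => rw [smul_mul_assoc]; exact Submodule.smul_mem _ _ h
    | smul_right r x y _ _ h => rw [mul_smul_comm]; exact Submodule.smul_mem _ _ h
  | star x hx' hx =>
    clear hx'
    induction hx using Submodule.span_induction with
    | mem x hx =>
      obtain ⟨k, rfl⟩ := hx
      rw [star_U]
      exact Submodule.smul_mem _ _ (Submodule.subset_span ⟨_, rfl⟩)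
    | zero => simp
    | add x y _ _ h1 h2 => rw [star_add]; exact Submodule.add_mem _ h1 h2
    | smul r x _ h => rw [star_smul]; exact Submodule.smul_mem _ _ h

theorem dense_span_unit (Θ : Matrix ι ι ℝ) :
    Dense (Submodule.span ℂ (Set.range (unit Θ)) : Set (Torus Θ)) := by
  intro a
  rw [closure_subtype]
  have h : (Subtype.val '' (Submodule.span ℂ (Set.range (unit Θ)) : Set (Torus Θ))) =
      (Submodule.span ℂ (Set.range (U Θ)) : Set (L2 ι →L[ℂ] L2 ι)) := by
    have h1 := Submodule.map_span (torusSubalgebra Θ).subtype.toAlgHom.toLinearMap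
      (Set.range (unit Θ))
    rw [← Set.range_comp] at h1
    exact congrArg SetLike.coe h1
  rw [h]
  exact closure_mono (fun x hx => mem_span_range_U Θ hx) a.2

/-- Approximation of an element of the torus by finite linear combinations of the `U_k`. -/
theorem exists_norm_sub_lt (Θ : Matrix ι ι ℝ) (a : Torus Θ) {ε : ℝ} (hε : 0 < ε) :
    ∃ b ∈ Submodule.span ℂ (Set.range (unit Θ)), ‖a - b‖ < ε := by
  obtain ⟨b, hb, h⟩ := Metric.dense_iff.1 (dense_span_unit Θ) a ε hε
  refine ⟨b, h, ?_⟩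
  rwa [← dist_eq_norm, dist_comm]

/-- Continuous linear maps that agree on the `U_k` are equal. -/
theorem map_eq_of_unit {Θ : Matrix ι ι ℝ} {E : Type*} [NormedAddCommGroup E] [NormedSpace ℂ E]
    {F G : Type*} [FunLike F (Torus Θ) E] [FunLike G (Torus Θ) E]
    [LinearMapClass F ℂ (Torus Θ) E] [LinearMapClass G ℂ (Torus Θ) E] (f : F) (g : G)
    (hf : Continuous f) (hg : Continuous g)
    (h : ∀ k, f (unit Θ k) = g (unit Θ k)) (a : Torus Θ) : f a = g a := by
  have := ContinuousLinearMap.ext_on (dense_span_unit Θ)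
    (f := ⟨LinearMapClass.linearMap f, hf⟩) (g := ⟨LinearMapClass.linearMap g, hg⟩) (by
      rintro _ ⟨k, rfl⟩
      exact h k)
  exact congrArg (fun T : Torus Θ →L[ℂ] E => T a) this

theorem continuous_starAlgHom {A B : Type*} [CStarAlgebra A] [CStarAlgebra B] (f : A →⋆ₐ[ℂ] B) :
    Continuous f :=
  AddMonoidHomClass.continuous_of_bound f 1 fun a => by
    rw [one_mul]; exact NonUnitalStarAlgHom.norm_apply_le f a

theorem starAlgHom_ext {Θ : Matrix ι ι ℝ} {B : Type*} [CStarAlgebra B] {f g : Torus Θ →⋆ₐ[ℂ] B}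
    (h : ∀ k, f (unit Θ k) = g (unit Θ k)) : f = g :=
  StarAlgHom.ext (map_eq_of_unit f g (continuous_starAlgHom f) (continuous_starAlgHom g) h)

theorem starAlgEquiv_ext {Θ : Matrix ι ι ℝ} {f g : Torus Θ ≃⋆ₐ[ℂ] Torus Θ}
    (h : ∀ k, f (unit Θ k) = g (unit Θ k)) : f = g :=
  StarAlgEquiv.ext (map_eq_of_unit f g (StarAlgEquiv.isometry f).continuous
    (StarAlgEquiv.isometry g).continuous h)

theorem separableSpace (Θ : Matrix ι ι ℝ) : TopologicalSpace.SeparableSpace (Torus Θ) := by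
  have h : TopologicalSpace.IsSeparable (Set.range (unit Θ)) :=
    (Set.countable_range _).isSeparable
  have h2 := (h.span (R := ℂ)).closure
  rw [(dense_span_unit Θ).closure_eq] at h2
  exact TopologicalSpace.isSeparable_univ_iff.1 h2

/-! ### The gauge action -/

/-- The real number `s · k`. -/
def dotInt (s : ι → ℝ) (k : ι → ℤ) : ℝ := ∑ j, s j * k j

theorem dotInt_add_left (s t : ι → ℝ) (k : ι → ℤ) :
    dotInt (s + t) k = dotInt s k + dotInt t k := by
  simp [dotInt, add_mul, Finset.sum_add_distrib]

theorem dotInt_smul_left (c : ℝ) (s : ι → ℝ) (k : ι → ℤ) :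
    dotInt (c • s) k = c * dotInt s k := by
  simp [dotInt, Finset.mul_sum, mul_assoc]

theorem dotInt_smul_right (c : ℤ) (s : ι → ℝ) (k : ι → ℤ) :
    dotInt s (c • k) = c * dotInt s k := by
  simp [dotInt, Finset.mul_sum, mul_left_comm]

theorem dotInt_sub_right (s : ι → ℝ) (k l : ι → ℤ) :
    dotInt s (k - l) = dotInt s k - dotInt s l := by
  simp [dotInt, mul_sub, Finset.sum_sub_distrib]

theorem dotInt_single [DecidableEq ι] (s : ι → ℝ) (j : ι) :
    dotInt s (Pi.single j 1) = s j := by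
  simp [dotInt, Pi.single_apply]

theorem dotInt_zero_left (k : ι → ℤ) : dotInt 0 k = 0 := by simp [dotInt]

/-- The diagonal unitary `(V f)(k) = exp(2π i s · k) f(k)`. -/
def diagonal (s : ι → ℝ) : L2 ι →L[ℂ] L2 ι :=
  weightedComp (Equiv.refl _) (Equiv.refl _).injective (fun k => phase (2 * dotInt s k))
    (fun _ => norm_phase _)

theorem diagonal_apply (s : ι → ℝ) (f : L2 ι) (k : ι → ℤ) :
    diagonal s f k = phase (2 * dotInt s k) * f k := rfl

theorem star_diagonal (s : ι → ℝ) : star (diagonal s) = diagonal (-s) := by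
  refine (star_weightedComp (Equiv.refl _) _ fun _ => norm_phase _).trans ?_
  ext f k
  change star (phase (2 * dotInt s k)) * f k = phase (2 * dotInt (-s) k) * f k
  rw [star_phase]
  congr 2
  simp [dotInt]

theorem diagonal_mul (s t : ι → ℝ) : diagonal s * diagonal t = diagonal (s + t) := by
  ext f k
  change diagonal s (diagonal t f) k = _
  rw [diagonal_apply, diagonal_apply, diagonal_apply, dotInt_add_left, mul_add, phase_add,
    mul_assoc]

theorem diagonal_zero : diagonal (0 : ι → ℝ) = 1 := by
  ext f k
  simp [diagonal_apply, dotInt_zero_left, phase_zero]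

theorem diagonal_mem_unitary (s : ι → ℝ) : diagonal s ∈ unitary (L2 ι →L[ℂ] L2 ι) := by
  rw [Unitary.mem_iff, star_diagonal, diagonal_mul, diagonal_mul, neg_add_cancel, add_neg_cancel]
  exact ⟨diagonal_zero, diagonal_zero⟩

/-- Translation by `k` changes the character `l ↦ exp(2π i s · l)` by a constant factor. Conjugation
thus provides the gauge automorphisms directly on operators, for every real `s`, with no appeal to a
universal property. -/
theorem diagonal_conj_U (Θ : Matrix ι ι ℝ) (s : ι → ℝ) (k : ι → ℤ) :
    diagonal s * U Θ k * star (diagonal s) = phase (2 * dotInt s k) • U Θ k := by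
  have h : diagonal s * U Θ k = (phase (2 * dotInt s k) • U Θ k) * diagonal s := by
    ext f l
    change diagonal s (U Θ k f) l = phase (2 * dotInt s k) * U Θ k (diagonal s f) l
    rw [diagonal_apply, U_apply, U_apply, diagonal_apply, dotInt_sub_right, mul_sub,
      show 2 * dotInt s l = 2 * dotInt s k + (2 * dotInt s l - 2 * dotInt s k) by ring, phase_add]
    ring_nf
  rw [h, mul_assoc, (Unitary.mem_iff.1 (diagonal_mem_unitary s)).2, mul_one]

theorem diagonal_conj_mem (Θ : Matrix ι ι ℝ) (s : ι → ℝ) (T : L2 ι →L[ℂ] L2 ι)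
    (hT : T ∈ torusSubalgebra Θ) :
    Unitary.conjStarAlgAut ℂ _ ⟨diagonal s, diagonal_mem_unitary s⟩ T ∈ torusSubalgebra Θ := by
  set α := Unitary.conjStarAlgAut ℂ _ (⟨diagonal s, diagonal_mem_unitary s⟩ :
    unitary (L2 ι →L[ℂ] L2 ι))
  have hc : Continuous α := (StarAlgEquiv.isometry α).continuous
  have h1 : torusSubalgebra Θ ≤ (torusSubalgebra Θ).comap (α : _ →⋆ₐ[ℂ] _) := by
    refine StarSubalgebra.topologicalClosure_minimal ?_
      ((StarSubalgebra.isClosed_topologicalClosure _).preimage hc)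
    refine StarAlgebra.adjoin_le ?_
    rintro _ ⟨k, rfl⟩
    change α (U Θ k) ∈ torusSubalgebra Θ
    rw [Unitary.conjStarAlgAut_apply, diagonal_conj_U]
    exact (torusSubalgebra Θ).smul_mem (unit Θ k).2 _
  exact h1 hT

/-- The gauge action `U_k ↦ exp(2π i s · k) U_k` as a *-homomorphism. -/
def gaugeHom (Θ : Matrix ι ι ℝ) (s : ι → ℝ) : Torus Θ →⋆ₐ[ℂ] Torus Θ :=
  (((Unitary.conjStarAlgAut ℂ _ (⟨diagonal s, diagonal_mem_unitary s⟩ :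
    unitary (L2 ι →L[ℂ] L2 ι)) :) : (L2 ι →L[ℂ] L2 ι) →⋆ₐ[ℂ] (L2 ι →L[ℂ] L2 ι)).comp (torusSubalgebra Θ).subtype).codRestrict
      (torusSubalgebra Θ) fun T => diagonal_conj_mem Θ s T.1 T.2

theorem gaugeHom_unit (Θ : Matrix ι ι ℝ) (s : ι → ℝ) (k : ι → ℤ) :
    gaugeHom Θ s (unit Θ k) = phase (2 * dotInt s k) • unit Θ k :=
  Subtype.ext (diagonal_conj_U Θ s k)

theorem gaugeHom_comp (Θ : Matrix ι ι ℝ) (s t : ι → ℝ) :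
    (gaugeHom Θ s).comp (gaugeHom Θ t) = gaugeHom Θ (s + t) := by
  refine starAlgHom_ext fun k => ?_
  rw [StarAlgHom.comp_apply, gaugeHom_unit, map_smul, gaugeHom_unit, gaugeHom_unit, smul_smul,
    ← phase_add, dotInt_add_left]
  congr 2; ring

theorem gaugeHom_zero (Θ : Matrix ι ι ℝ) : gaugeHom Θ 0 = StarAlgHom.id ℂ _ := by
  refine starAlgHom_ext fun k => ?_
  rw [gaugeHom_unit, dotInt_zero_left, mul_zero, phase_zero, one_smul]
  rfl

/-- The *-automorphism `U_k ↦ exp(2π i s · k) U_k`. -/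
def gauge (Θ : Matrix ι ι ℝ) (s : ι → ℝ) : Torus Θ ≃⋆ₐ[ℂ] Torus Θ :=
  StarAlgEquiv.ofStarAlgHom (gaugeHom Θ s) (gaugeHom Θ (-s))
    (by rw [gaugeHom_comp, neg_add_cancel, gaugeHom_zero])
    (by rw [gaugeHom_comp, add_neg_cancel, gaugeHom_zero])

theorem gauge_unit (Θ : Matrix ι ι ℝ) (s : ι → ℝ) (k : ι → ℤ) :
    gauge Θ s (unit Θ k) = phase (2 * dotInt s k) • unit Θ k := gaugeHom_unit Θ s k

theorem gauge_add (Θ : Matrix ι ι ℝ) (s t : ι → ℝ) :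
    gauge Θ (s + t) = gauge Θ s * gauge Θ t := by
  refine starAlgEquiv_ext fun k => ?_
  rw [StarAlgEquiv.mul_apply, gauge_unit, gauge_unit, map_smul, gauge_unit, smul_smul,
    ← phase_add, dotInt_add_left]
  congr 2; ring

theorem gauge_zero (Θ : Matrix ι ι ℝ) : gauge Θ 0 = 1 := by
  refine starAlgEquiv_ext fun k => ?_
  rw [gauge_unit, dotInt_zero_left, mul_zero, phase_zero, one_smul, StarAlgEquiv.one_apply]

theorem norm_gauge (Θ : Matrix ι ι ℝ) (s : ι → ℝ) (a : Torus Θ) : ‖gauge Θ s a‖ = ‖a‖ :=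
  StarAlgEquiv.norm_map (gauge Θ s) a

theorem continuous_gauge (Θ : Matrix ι ι ℝ) (s : ι → ℝ) : Continuous (gauge Θ s) :=
  (StarAlgEquiv.isometry (gauge Θ s)).continuous

theorem phase_eq_one_iff (x : ℝ) : phase (2 * x) = 1 ↔ ∃ n : ℤ, x = n := by
  rw [phase, Complex.exp_eq_one_iff]
  refine exists_congr fun n => ?_
  have hpi : (Real.pi : ℂ) ≠ 0 := by exact_mod_cast Real.pi_ne_zero
  constructor
  · intro h
    have h2 : ((x : ℂ)) = n := by
      have h3 : (2 * Real.pi * Complex.I : ℂ) * x = (2 * Real.pi * Complex.I) * n := by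
        push_cast at h
        linear_combination h
      exact mul_left_cancel₀ Complex.two_pi_I_ne_zero h3
    exact_mod_cast h2
  · rintro rfl
    push_cast
    ring

/-- The generator `U_{e_j}` is nonzero and is multiplied by `exp(2π i s_j)`, so it detects whether
`s_j` is an integer. All later identifications of automorphism groups rest on this kernel. -/
theorem gauge_eq_one_iff (Θ : Matrix ι ι ℝ) (s : ι → ℝ) :
    gauge Θ s = 1 ↔ ∀ j, ∃ n : ℤ, s j = n := by
  classical
  constructor
  · intro h j
    have h1 := gauge_unit Θ s (Pi.single j 1)
    rw [h, StarAlgEquiv.one_apply, dotInt_single] at h1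
    refine (phase_eq_one_iff _).1 ?_
    refine smul_left_injective ℂ (unit_ne_zero Θ (Pi.single j 1)) ?_
    simpa using h1.symm
  · intro h
    choose n hn using h
    refine starAlgEquiv_ext fun k => ?_
    rw [gauge_unit, StarAlgEquiv.one_apply, (phase_eq_one_iff _).2, one_smul]
    exact ⟨∑ j, n j * k j, by simp [dotInt, hn]⟩

theorem gauge_eq_gauge_iff (Θ : Matrix ι ι ℝ) (s t : ι → ℝ) :
    gauge Θ s = gauge Θ t ↔ ∀ j, ∃ n : ℤ, s j - t j = n := by
  rw [← sub_add_cancel s t, gauge_add, mul_eq_right, gauge_eq_one_iff]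
  simp

end NCTorus

namespace NCTorus

variable {ι : Type} [Fintype ι]

/-! ### Averages over rotation groups -/

theorem phase_sum {κ : Type*} (s : Finset κ) (x : κ → ℝ) :
    phase (∑ j ∈ s, x j) = ∏ j ∈ s, phase (x j) := by
  classical
  induction s using Finset.induction_on with
  | empty => simp [phase_zero]
  | insert a s ha ih => rw [Finset.sum_insert ha, Finset.prod_insert ha, phase_add, ih]

theorem phase_nat_mul (n : ℕ) (x : ℝ) : phase (n * x) = phase x ^ n := by
  induction n with
  | zero => simp [phase_zero]
  | succ n ih => rw [pow_succ, ← ih, ← phase_add]; congr 1; push_cast; ring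

/-- A geometric sum over the powers of an `r`-th root of unity different from `1`. -/
theorem sum_phase_eq_zero (r : ℕ) [NeZero r] (k : ℤ) (hk : ¬ (r : ℤ) ∣ k) :
    ∑ x : Fin r, phase (2 * (((x : ℕ) : ℝ) / r * k)) = 0 := by
  have hr : (r : ℝ) ≠ 0 := NeZero.ne _
  have h1 : phase (2 * ((k : ℝ) / r)) ≠ 1 := by
    rw [Ne, phase_eq_one_iff]
    rintro ⟨n, hn⟩
    refine hk ⟨n, ?_⟩
    rw [div_eq_iff hr] at hn
    have h2 : k = n * r := by exact_mod_cast hn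
    rw [h2, mul_comm]
  have h2 : phase (2 * ((k : ℝ) / r)) ^ r = 1 := by
    rw [← phase_nat_mul, mul_left_comm, phase_eq_one_iff]
    exact ⟨k, by field_simp⟩
  have h3 : ∀ x : Fin r, phase (2 * (((x : ℕ) : ℝ) / r * k)) =
      phase (2 * ((k : ℝ) / r)) ^ (x : ℕ) := fun x => by
    rw [← phase_nat_mul]; congr 1; ring
  rw [Finset.sum_congr rfl fun x _ => h3 x,
    Fin.sum_univ_eq_sum_range (fun x => phase (2 * ((k : ℝ) / r)) ^ x), geom_sum_eq h1, h2,
    sub_self, zero_div]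

/-- The rational vector `t / r`. -/
def frac (r : ℕ) (t : ι → ℤ) : ι → ℝ := fun j => t j / r

omit [Fintype ι] in
theorem frac_add (r : ℕ) (t t' : ι → ℤ) : frac r (t + t') = frac r t + frac r t' := by
  funext j; simp [frac, add_div]

/-- The integer vector of a residue vector. -/
def lift {r : ℕ} (c : ι → Fin r) : ι → ℤ := fun j => ((c j : ℕ) : ℤ)

theorem dotInt_frac (r : ℕ) (t k : ι → ℤ) :
    dotInt (frac r t) k = ((∑ j, t j * k j : ℤ) : ℝ) / r := by
  simp only [dotInt, frac, Finset.sum_div, Int.cast_sum, Int.cast_mul]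
  exact Finset.sum_congr rfl fun j _ => by ring

theorem dotInt_frac_comm (r : ℕ) (t k : ι → ℤ) : dotInt (frac r t) k = dotInt (frac r k) t := by
  simp only [dotInt_frac, mul_comm]

variable [DecidableEq ι]

/-- Orthogonality of characters of `(ℤ/r)ⁿ`: the sum factors over the coordinates, and one
coordinate not divisible by `r` makes its factor vanish. -/
theorem sum_phase_lift (r : ℕ) [NeZero r] (k : ι → ℤ) [Decidable (∀ j, (r : ℤ) ∣ k j)] :
    ∑ c : ι → Fin r, phase (2 * dotInt (frac r (lift c)) k) =
      if ∀ j, (r : ℤ) ∣ k j then (Fintype.card (ι → Fin r) : ℂ) else 0 := by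
  classical
  have hr : (r : ℝ) ≠ 0 := NeZero.ne _
  split_ifs with h
  · rw [Finset.sum_congr rfl (g := fun _ => (1 : ℂ))]
    · simp
    · intro c _
      choose n hn using h
      rw [phase_eq_one_iff, dotInt_frac_comm]
      refine ⟨∑ j, n j * lift c j, ?_⟩
      simp only [dotInt, frac, hn]
      push_cast
      exact Finset.sum_congr rfl fun j _ => by field_simp
  · push Not at h
    obtain ⟨j, hj⟩ := h
    have h1 : ∀ c : ι → Fin r, phase (2 * dotInt (frac r (lift c)) k) =
        ∏ i, phase (2 * (((c i : ℕ) : ℝ) / r * k i)) := fun c => by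
      rw [← phase_sum, ← Finset.mul_sum]
      simp [dotInt, frac, lift]
    rw [Finset.sum_congr rfl fun c _ => h1 c,
      ← Fintype.prod_sum fun i (x : Fin r) => phase (2 * (((x : ℕ) : ℝ) / r * k i))]
    exact Finset.prod_eq_zero (Finset.mem_univ j) (sum_phase_eq_zero r _ hj)

/-- The average over the rotations by multiples of `1 / r`. -/
def average (Θ : Matrix ι ι ℝ) (r : ℕ) : Torus Θ →ₗ[ℂ] Torus Θ where
  toFun a := (Fintype.card (ι → Fin r) : ℂ)⁻¹ • ∑ c : ι → Fin r, gauge Θ (frac r (lift c)) a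
  map_add' a b := by simp [Finset.sum_add_distrib]
  map_smul' z a := by simp [← Finset.smul_sum, smul_comm z]

theorem average_apply (Θ : Matrix ι ι ℝ) (r : ℕ) (a : Torus Θ) : average Θ r a =
    (Fintype.card (ι → Fin r) : ℂ)⁻¹ • ∑ c : ι → Fin r, gauge Θ (frac r (lift c)) a := rfl

theorem continuous_average (Θ : Matrix ι ι ℝ) (r : ℕ) : Continuous (average Θ r) :=
  Continuous.fun_const_smul (continuous_finsetSum _ fun _ _ => continuous_gauge Θ _) _

theorem card_ne_zero (r : ℕ) [NeZero r] : (Fintype.card (ι → Fin r) : ℂ) ≠ 0 := by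
  exact_mod_cast Fintype.card_ne_zero

theorem average_unit (Θ : Matrix ι ι ℝ) (r : ℕ) [NeZero r] (k : ι → ℤ)
    [Decidable (∀ j, (r : ℤ) ∣ k j)] :
    average Θ r (unit Θ k) = if ∀ j, (r : ℤ) ∣ k j then unit Θ k else 0 := by
  rw [average_apply]
  simp only [gauge_unit]
  rw [← Finset.sum_smul, sum_phase_lift]
  split_ifs
  · rw [smul_smul, inv_mul_cancel₀ (card_ne_zero r), one_smul]
  · simp

theorem average_eq_self (Θ : Matrix ι ι ℝ) (r : ℕ) [NeZero r] (a : Torus Θ)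
    (h : ∀ t : ι → ℤ, gauge Θ (frac r t) a = a) : average Θ r a = a := by
  simp only [average_apply, h, Finset.sum_const, Finset.card_univ]
  rw [← Nat.cast_smul_eq_nsmul ℂ, smul_smul, inv_mul_cancel₀ (card_ne_zero r), one_smul]

/-- The norm of an average of vectors is bounded by a bound of their norms. -/
theorem norm_card_inv_smul_sum_le {κ E : Type*} [Fintype κ] [Nonempty κ] [NormedAddCommGroup E]
    [NormedSpace ℂ E] (v : κ → E) (C : ℝ) (h : ∀ c, ‖v c‖ ≤ C) :
    ‖(Fintype.card κ : ℂ)⁻¹ • ∑ c, v c‖ ≤ C := by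
  have hc : (0 : ℝ) < Fintype.card κ := by exact_mod_cast Fintype.card_pos
  rw [norm_smul, norm_inv, Complex.norm_natCast, inv_mul_le_iff₀ hc]
  refine (norm_sum_le_of_le _ fun c _ => h c).trans ?_
  simp

theorem norm_average_le (Θ : Matrix ι ι ℝ) (r : ℕ) [NeZero r] (a : Torus Θ) :
    ‖average Θ r a‖ ≤ ‖a‖ :=
  norm_card_inv_smul_sum_le _ _ fun _ => (norm_gauge Θ _ a).le

/-- An injective *-homomorphism is isometric, so its range is closed and it suffices to average the
`U_k`. The result is `0` or a `U_k` with `k ∈ rℤⁿ`. -/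
theorem average_mem_range {A : Type*} [CStarAlgebra A] (Θ : Matrix ι ι ℝ) (r : ℕ) [NeZero r]
    (φ : A →⋆ₐ[ℂ] Torus Θ) (hφ : Function.Injective φ)
    (h : ∀ k : ι → ℤ, unit Θ ((r : ℤ) • k) ∈ Set.range φ) (a : Torus Θ) :
    average Θ r a ∈ Set.range φ := by
  classical
  have hcl : IsClosed (Set.range φ) :=
    (NonUnitalStarAlgHom.isometry φ hφ).isClosedEmbedding.isClosed_range
  let S : Submodule ℂ (Torus Θ) :=
    (LinearMap.range (φ.toAlgHom.toLinearMap)).comap (average Θ r)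
  have hS : IsClosed (S : Set (Torus Θ)) := hcl.preimage (continuous_average Θ r)
  have h1 : Submodule.span ℂ (Set.range (unit Θ)) ≤ S := by
    refine Submodule.span_le.2 ?_
    rintro _ ⟨k, rfl⟩
    change average Θ r (unit Θ k) ∈ Set.range φ
    rw [average_unit]
    split_ifs with hk
    · choose n hn using hk
      have : k = (r : ℤ) • n := funext hn
      rw [this]
      exact h n
    · exact ⟨0, map_zero φ⟩
  have h2 : (Set.univ : Set (Torus Θ)) ⊆ S := by
    rw [← (dense_span_unit Θ).closure_eq]
    exact closure_minimal h1 hS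
  exact h2 (Set.mem_univ a)

/-! ### Coverings -/

omit [DecidableEq ι] in
theorem mem_rotations_iff (Θ : Matrix ι ι ℝ) (r : ℕ) (g : Torus Θ ≃⋆ₐ[ℂ] Torus Θ) :
    g ∈ rotations Θ r ↔ ∃ t : ι → ℤ, g = gauge Θ (frac r t) := by
  have h : ∀ t k : ι → ℤ, gauge Θ (frac r t) (unit Θ k) =
      phase (2 * ((∑ j, t j * k j : ℤ) : ℝ) / r) • unit Θ k := fun t k => by
    rw [gauge_unit, dotInt_frac, mul_div_assoc]
  refine exists_congr fun t => ⟨fun ht => starAlgEquiv_ext fun k => ?_, ?_⟩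
  · rw [ht, h]
  · rintro rfl k
    exact h t k

omit [DecidableEq ι] in
theorem gauge_frac_mem (Θ : Matrix ι ι ℝ) (r : ℕ) (t : ι → ℤ) :
    gauge Θ (frac r t) ∈ rotations Θ r := (mem_rotations_iff Θ r _).2 ⟨t, rfl⟩

omit [DecidableEq ι] in
theorem gauge_frac_eq_iff (Θ : Matrix ι ι ℝ) (r : ℕ) [NeZero r] (t t' : ι → ℤ) :
    gauge Θ (frac r t) = gauge Θ (frac r t') ↔ ∀ j, (t j : ZMod r) = t' j := by
  have hr : (r : ℝ) ≠ 0 := NeZero.ne _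
  rw [gauge_eq_gauge_iff]
  refine forall_congr' fun j => ?_
  rw [eq_comm, ZMod.intCast_eq_intCast_iff, Int.modEq_iff_dvd]
  refine exists_congr fun n => ?_
  rw [frac, frac, ← sub_div, div_eq_iff hr, mul_comm]
  norm_cast

-- A rotation is determined by the residue mod `r` of any integer vector representing it.
omit [DecidableEq ι] in
theorem finite_rotations (Θ : Matrix ι ι ℝ) (r : ℕ) [NeZero r] : Finite (rotations Θ r) := by
  let ψ : rotations Θ r → (ι → ZMod r) := fun g j =>
    (((mem_rotations_iff Θ r g.1).1 g.2).choose j : ZMod r)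
  refine Finite.of_injective ψ fun g g' h => Subtype.ext ?_
  rw [((mem_rotations_iff Θ r g.1).1 g.2).choose_spec,
    ((mem_rotations_iff Θ r g'.1).1 g'.2).choose_spec, gauge_frac_eq_iff]
  exact congrFun h

/-- Since `U_c` is a unitary eigenvector of the rotation, each summand is a phase. Exchanging the
roles of `c` and `t` in the exponent turns the sum into a character sum over `c`. -/
theorem sum_frame (Θ : Matrix ι ι ℝ) (r : ℕ) [NeZero r] (t : ι → ℤ)
    [Decidable (∀ j, (r : ℤ) ∣ t j)] :
    ∑ c : ι → Fin r, unit Θ (lift c) * gauge Θ (frac r t) (star (unit Θ (lift c))) =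
      (if ∀ j, (r : ℤ) ∣ t j then (Fintype.card (ι → Fin r) : ℂ) else 0) • 1 := by
  classical
  have h : ∀ c : ι → Fin r, unit Θ (lift c) * gauge Θ (frac r t) (star (unit Θ (lift c))) =
      phase (2 * dotInt (frac r (lift c)) (-t)) • 1 := fun c => by
    rw [map_star, gauge_unit, star_smul, mul_smul_comm, unit_mul_star, star_phase,
      dotInt_frac_comm]
    congr 2
    simp [dotInt]
  rw [Finset.sum_congr rfl fun c _ => h c, ← Finset.sum_smul, sum_phase_lift]
  simp

theorem isFiniteCovering_of_unit {Θ Θ' : Matrix ι ι ℝ} (r : ℕ) [NeZero r]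
    (φ : Torus Θ' →⋆ₐ[ℂ] Torus Θ) (hφ : Function.Injective φ)
    (h : ∀ k, φ (unit Θ' k) = unit Θ ((r : ℤ) • k)) :
    CStarTower.IsFiniteCovering φ (rotations Θ r) where
  injective := hφ
  finite := finite_rotations Θ r
  fixed := by
    refine Set.Subset.antisymm (fun b hb => ?_) ?_
    -- A fixed element equals its own average, and averages lie in the range.
    · rw [← average_eq_self Θ r b fun t => hb _ (gauge_frac_mem Θ r t)]
      exact average_mem_range Θ r φ hφ (fun k => ⟨_, h k⟩) b
    · rintro _ ⟨a, rfl⟩ g hg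
      obtain ⟨t, rfl⟩ := (mem_rotations_iff Θ r g).1 hg
      have h1 : ((gaugeHom Θ (frac r t)).comp φ) = φ := by
        refine starAlgHom_ext fun k => ?_
        rw [StarAlgHom.comp_apply, h, gaugeHom_unit, (phase_eq_one_iff _).2, one_smul]
        have hr : (r : ℝ) ≠ 0 := NeZero.ne _
        refine ⟨∑ j, t j * k j, ?_⟩
        rw [dotInt_smul_right, dotInt_frac]
        push_cast
        field_simp
      exact congrArg (fun f : Torus Θ' →⋆ₐ[ℂ] Torus Θ => f a) h1
  frame := by
    classical
    have hc : (0 : ℝ) < Fintype.card (ι → Fin r) := by exact_mod_cast Fintype.card_pos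
    -- The frame is `w⁻¹ U_c`, one element per residue vector. Each product contains two factors
    -- `w⁻¹`, hence the square root; `w` is real, so the adjoint does not change it.
    set w : ℂ := ((Real.sqrt (Fintype.card (ι → Fin r)) : ℝ) : ℂ) with hw
    have hww : w * w = (Fintype.card (ι → Fin r) : ℂ) := by
      rw [hw, ← Complex.ofReal_mul, Real.mul_self_sqrt hc.le, Complex.ofReal_natCast]
    have hws : star w = w := Complex.conj_ofReal _
    have key : ∀ t : ι → ℤ, ∑ c : ι → Fin r, (w⁻¹ • unit Θ (lift c)) *
        gauge Θ (frac r t) (star (w⁻¹ • unit Θ (lift c))) =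
          if ∀ j, (r : ℤ) ∣ t j then 1 else 0 := fun t => by
      have h1 : ∀ c : ι → Fin r, (w⁻¹ • unit Θ (lift c)) *
          gauge Θ (frac r t) (star (w⁻¹ • unit Θ (lift c))) = (w * w)⁻¹ •
            (unit Θ (lift c) * gauge Θ (frac r t) (star (unit Θ (lift c)))) := fun c => by
        rw [star_smul, map_smul, smul_mul_smul_comm, star_inv₀, hws, mul_inv]
      rw [Finset.sum_congr rfl fun c _ => h1 c, ← Finset.smul_sum, sum_frame, hww, smul_smul]
      split_ifs
      · rw [inv_mul_cancel₀ (card_ne_zero r), one_smul]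
      · simp
    refine ⟨ι → Fin r, inferInstance, fun c => w⁻¹ • unit Θ (lift c), ?_, fun g hg h1 => ?_⟩
    · have h0 := key 0
      have hz : frac r (0 : ι → ℤ) = 0 := by funext j; simp [frac]
      rw [hz, gauge_zero] at h0
      simp only [StarAlgEquiv.one_apply, Pi.zero_apply, dvd_zero, implies_true, if_true] at h0
      rw [← h0]
      exact hasSum_fintype _
    · obtain ⟨t, rfl⟩ := (mem_rotations_iff Θ r g).1 hg
      have h0 := key t
      rw [if_neg] at h0
      · rw [← h0]
        exact hasSum_fintype _
      · intro hd
        refine h1 ?_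
        rw [gauge_eq_one_iff]
        intro j
        obtain ⟨n, hn⟩ := hd j
        have hr : (r : ℝ) ≠ 0 := NeZero.ne _
        exact ⟨n, by rw [frac, hn]; push_cast; field_simp⟩

/-- The image of `T` is a direct sum of copies of `T`. Compression to the single summand `c = 0`
recovers `T`. -/
theorem cover_injective {Θ Θ' : Matrix ι ι ℝ} (p : ℕ) [NeZero p]
    (h : Θ = ((p : ℝ) ^ 2) • Θ') : Function.Injective (cover p h) := by
  rw [injective_iff_map_eq_zero]
  intro T hT
  have h1 : amplify Θ' p T.1 = 0 := congrArg Subtype.val hT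
  have hs : ∀ c c' : ι → Fin p, slice Θ' p c * star (slice Θ' p c') = if c = c' then 1 else 0 :=
    slice_adjoint Θ' p
  set c : ι → Fin p := fun _ => 0
  have h2 : slice Θ' p c * amplify Θ' p T.1 * star (slice Θ' p c) = T.1 := by
    change slice Θ' p c * (∑ d : ι → Fin p, star (slice Θ' p d) * T.1 * slice Θ' p d) *
      star (slice Θ' p c) = T.1
    rw [Finset.mul_sum, Finset.sum_mul, Finset.sum_eq_single c]
    · calc slice Θ' p c * (star (slice Θ' p c) * T.1 * slice Θ' p c) * star (slice Θ' p c)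
          = (slice Θ' p c * star (slice Θ' p c)) * T.1 * (slice Θ' p c * star (slice Θ' p c)) := by
            simp only [mul_assoc]
        _ = T.1 := by rw [hs, if_pos rfl, one_mul, mul_one]
    · intro d _ hd
      rw [← mul_assoc, ← mul_assoc, hs, if_neg hd.symm]
      simp
    · simp
  rw [h1, mul_zero, zero_mul] at h2
  exact Subtype.ext h2.symm

/-! ### Irreducibility -/

/-- An element fixed by the gauge action is a scalar. -/
theorem mem_range_algebraMap_of_gauge (Θ : Matrix ι ι ℝ) (a : Torus Θ)
    (h : ∀ s, gauge Θ s a = a) : ∃ z : ℂ, a = z • 1 := by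
  classical
  -- For a finite linear combination, averaging with `r` large enough leaves only the coefficient of
  -- `U_0 = 1`. This plays the role of integration over the torus.
  have key : ∀ b ∈ Submodule.span ℂ (Set.range (unit Θ)), ∃ R : ℕ, ∀ r : ℕ, R < r →
      average Θ r b ∈ Submodule.span ℂ {(1 : Torus Θ)} := by
    intro b hb
    induction hb using Submodule.span_induction with
    | mem x hx =>
      obtain ⟨k, rfl⟩ := hx
      -- The bound exceeds or equals every `|k_j|`, so a larger `r` divides all `k_j` only if `k =
      -- 0`.
      refine ⟨∑ j, (k j).natAbs, fun r hr => ?_⟩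
      have : NeZero r := ⟨by omega⟩
      rw [average_unit]
      split_ifs with hd
      · have hk : k = 0 := by
          funext j
          refine Int.eq_zero_of_dvd_of_natAbs_lt_natAbs (hd j) ?_
          rw [Int.natAbs_natCast]
          exact (Finset.single_le_sum (f := fun j => (k j).natAbs) (fun _ _ => Nat.zero_le _)
            (Finset.mem_univ j)).trans_lt hr
        rw [hk, unit_zero]
        exact Submodule.mem_span_singleton_self _
      · exact Submodule.zero_mem _
    | zero => exact ⟨0, fun r _ => by rw [map_zero]; exact Submodule.zero_mem _⟩
    | add x y _ _ hx hy =>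
      obtain ⟨R, hR⟩ := hx
      obtain ⟨R', hR'⟩ := hy
      refine ⟨max R R', fun r hr => ?_⟩
      rw [map_add]
      exact Submodule.add_mem _ (hR r ((le_max_left _ _).trans_lt hr))
        (hR' r ((le_max_right _ _).trans_lt hr))
    | smul z x _ hx =>
      obtain ⟨R, hR⟩ := hx
      refine ⟨R, fun r hr => ?_⟩
      rw [map_smul]
      exact Submodule.smul_mem _ _ (hR r hr)
  have hcl : IsClosed (Submodule.span ℂ {(1 : Torus Θ)} : Set (Torus Θ)) :=
    Submodule.closed_of_finiteDimensional _
  have hmem : a ∈ Submodule.span ℂ {(1 : Torus Θ)} := by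
    rw [← SetLike.mem_coe, ← hcl.closure_eq, Metric.mem_closure_iff]
    intro ε hε
    obtain ⟨b, hb, hab⟩ := exists_norm_sub_lt Θ a hε
    obtain ⟨R, hR⟩ := key b hb
    refine ⟨_, hR (R + 1) (Nat.lt_succ_self R), ?_⟩
    rw [dist_eq_norm]
    calc ‖a - average Θ (R + 1) b‖ = ‖average Θ (R + 1) (a - b)‖ := by
          rw [map_sub, average_eq_self Θ (R + 1) a fun t => h _]
      _ ≤ ‖a - b‖ := norm_average_le Θ _ _
      _ < ε := hab
  obtain ⟨z, hz⟩ := Submodule.mem_span_singleton.1 hmem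
  exact ⟨z, hz.symm⟩

-- On finite combinations continuity is visible from the exponential coefficients. With isometry of
-- the action, this suffices for the approximation argument on central idempotents.
omit [DecidableEq ι] in
theorem continuous_gauge_smul (Θ : Matrix ι ι ℝ) (s : ι → ℝ) {b : Torus Θ}
    (hb : b ∈ Submodule.span ℂ (Set.range (unit Θ))) :
    Continuous fun t : ℝ => gauge Θ (t • s) b := by
  induction hb using Submodule.span_induction with
  | mem x hx =>
    obtain ⟨k, rfl⟩ := hx
    simp only [gauge_unit, dotInt_smul_left, phase]
    fun_prop
  | zero => simpa using continuous_const
  | add x y _ _ hx hy => simp only [map_add]; fun_prop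
  | smul z x _ hx => simp only [map_smul]; fun_prop

/-- Commuting idempotents at distance less than `1` are equal. -/
theorem eq_of_isIdempotentElem {A : Type*} [NormedRing A] {p q : A} (hp : p * p = p)
    (hq : q * q = q) (hc : p * q = q * p) (h : ‖p - q‖ < 1) : p = q := by
  -- For commuting idempotents the difference equals its own cube, so its norm is either `0` or at
  -- least `1`.
  have h3 : (p - q) = (p - q) * (p - q) * (p - q) := by
    have e1 : q * p * p = q * p := by rw [mul_assoc, hp]
    have e2 : q * p * q = q * p := by rw [mul_assoc, hc, ← mul_assoc, hq]
    simp only [sub_mul, mul_sub, hp, hq, hc, e1, e2]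
    abel
  by_contra hne
  have hpos : 0 < ‖p - q‖ := norm_pos_iff.2 (sub_ne_zero.2 hne)
  have h4 : ‖p - q‖ ≤ ‖p - q‖ * ‖p - q‖ * ‖p - q‖ := by
    conv_lhs => rw [h3]
    exact (norm_mul_le _ _).trans (mul_le_mul_of_nonneg_right (norm_mul_le _ _) hpos.le)
  have h5 : ‖p - q‖ * ‖p - q‖ < 1 := mul_lt_one_of_nonneg_of_lt_one_left hpos.le h h.le
  nlinarith

omit [DecidableEq ι] in
/-- A central idempotent of a noncommutative torus is fixed by the gauge action. -/
theorem gauge_eq_of_central (Θ : Matrix ι ι ℝ) {e : Torus Θ} (he : e * e = e)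
    (hc : ∀ x, e * x = x * e) (s : ι → ℝ) : gauge Θ s e = e := by
  -- Nearby points of the orbit are central idempotents at distance less than `1`, hence equal.
  -- Connectedness of `ℝ` then compares `t = 1` with `t = 0`.
  have hloc : IsLocallyConstant fun t : ℝ => gauge Θ (t • s) e := by
    rw [IsLocallyConstant.iff_eventually_eq]
    intro t₀
    -- Two approximation errors and one continuity error, each below `1/4`, add up to less than `1`.
    obtain ⟨b, hb, hab⟩ := exists_norm_sub_lt Θ e (ε := 1 / 4) (by norm_num)
    have h1 : ∀ᶠ t in 𝓝 t₀, dist (gauge Θ (t • s) b) (gauge Θ (t₀ • s) b) < 1 / 4 :=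
      Metric.tendsto_nhds.1 ((continuous_gauge_smul Θ s hb).tendsto t₀) _ (by norm_num)
    filter_upwards [h1] with t ht
    have hcent : ∀ u x, gauge Θ u e * x = x * gauge Θ u e := fun u x => by
      have := congrArg (gauge Θ u) (hc ((gauge Θ u).symm x))
      simpa using this
    refine eq_of_isIdempotentElem (by rw [← map_mul, he]) (by rw [← map_mul, he]) (hcent _ _) ?_
    rw [dist_eq_norm] at ht
    have e1 := norm_gauge Θ (t • s) (e - b)
    have e2 := norm_gauge Θ (t₀ • s) (e - b)
    have e3 : gauge Θ (t • s) e - gauge Θ (t₀ • s) e = gauge Θ (t • s) (e - b) +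
        (gauge Θ (t • s) b - gauge Θ (t₀ • s) b) - gauge Θ (t₀ • s) (e - b) := by
      simp only [map_sub]; abel
    rw [e3]
    refine (norm_sub_le _ _).trans_lt ?_
    have e4 := norm_add_le (gauge Θ (t • s) (e - b)) (gauge Θ (t • s) b - gauge Θ (t₀ • s) b)
    linarith
  have := hloc.apply_eq_of_preconnectedSpace 1 0
  simpa [gauge_zero] using this

/-- The idempotent of a direct sum decomposition is central, hence gauge invariant, hence a scalar
`z` with `z² = z`. -/
theorem isIrreducibleRing_torus (Θ : Matrix ι ι ℝ) : CStarTower.IsIrreducibleRing (Torus Θ) := by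
  rintro S T _ _ ⟨φ⟩
  -- The summands are not assumed unital; the components of `u` are their identities. If one of
  -- these vanishes, that summand is trivial.
  set u := φ 1 with hu
  have hl : ∀ x, u * x = x := fun x => by
    obtain ⟨y, rfl⟩ := φ.surjective x
    rw [hu, ← map_mul, one_mul]
  have hr : ∀ x, x * u = x := fun x => by
    obtain ⟨y, rfl⟩ := φ.surjective x
    rw [hu, ← map_mul, mul_one]
  have hS : ∀ x : S, u.1 * x = x ∧ x * u.1 = x := fun x =>
    ⟨congrArg Prod.fst (hl (x, 0)), congrArg Prod.fst (hr (x, 0))⟩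
  have hT : ∀ x : T, u.2 * x = x := fun x => congrArg Prod.snd (hl (0, x))
  set e := φ.symm (u.1, 0) with he
  have hee : e * e = e := by
    rw [he, ← map_mul, Prod.mk_mul_mk, (hS u.1).1, mul_zero]
  have hec : ∀ x, e * x = x * e := fun x => by
    refine φ.injective ?_
    rw [map_mul, map_mul, he, RingEquiv.apply_symm_apply]
    refine Prod.ext ?_ ?_
    · exact ((hS _).1).trans (hS _).2.symm
    · change 0 * (φ x).2 = (φ x).2 * 0
      rw [zero_mul, mul_zero]
  obtain ⟨z, hz⟩ := mem_range_algebraMap_of_gauge Θ e (gauge_eq_of_central Θ hee hec)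
  have hzz : z * z = z := by
    refine smul_left_injective ℂ (one_ne_zero (α := Torus Θ)) ?_
    change (z * z) • (1 : Torus Θ) = z • 1
    rw [← hz, ← hee, hz, smul_mul_smul_comm, one_mul]
  have h01 : z = 0 ∨ z = 1 := by
    have : z * (z - 1) = 0 := by rw [mul_sub, hzz, mul_one, sub_self]
    exact (mul_eq_zero.1 this).imp_right sub_eq_zero.1
  rcases h01 with rfl | rfl
  · left
    rw [zero_smul] at hz
    have h1 : (u.1, (0 : T)) = 0 := by
      rw [← φ.apply_symm_apply (u.1, 0), ← he, hz, map_zero]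
    have h2 : u.1 = 0 := congrArg Prod.fst h1
    exact ⟨fun x y => by rw [← (hS x).1, ← (hS y).1, h2, zero_mul, zero_mul]⟩
  · right
    rw [one_smul] at hz
    have h1 : (u.1, (0 : T)) = u := by
      rw [← φ.apply_symm_apply (u.1, 0), ← he, hz]
    have h2 : 0 = u.2 := congrArg Prod.snd h1
    exact ⟨fun x y => by rw [← hT x, ← hT y, ← h2, zero_mul, zero_mul]⟩

end NCTorus

/-! ### Compatible endomorphisms and the inductive limit -/

namespace CStarTower

universe u

variable {A : ℕ → Type u} [∀ n, CStarAlgebra (A n)] {π : ∀ n, A n →⋆ₐ[ℂ] A (n + 1)}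

theorem trans_injective (hπ : ∀ n, Function.Injective (π n)) {k m : ℕ} (h : k ≤ m) :
    Function.Injective (trans π h) := by
  induction m, h using Nat.le_induction with
  | base => intro a b hab; rwa [trans_self, trans_self] at hab
  | succ m hm ih => intro a b hab; rw [trans_succ π hm, trans_succ π hm] at hab; exact ih (hπ m hab)

/-- An automorphism that intertwines along `φ` with an automorphism preserves the range of `φ`. -/
theorem image_range_eq {A B : Type*} {φ : A → B} {g : B → B} {g' : A → A}
    (hg' : Function.Surjective g') (h : ∀ a, g (φ a) = φ (g' a)) :
    g '' Set.range φ = Set.range φ := by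
  rw [← Set.range_comp, show g ∘ φ = φ ∘ g' from funext h, hg'.range_comp]

namespace InductiveLimit

variable (φ : ∀ n, A n →⋆ₐ[ℂ] A n) (hφ : ∀ n a, φ (n + 1) (π n a) = π n (φ n a))

/-- The action of a compatible family of endomorphisms on eventually coherent sequences. -/
def mapThread : Thread π →+ Thread π where
  toFun x := ⟨fun n => φ n (x.1 n), by
    filter_upwards [x.2] with n hn
    rw [hn, hφ]⟩
  map_zero' := Subtype.ext (funext fun n => map_zero (φ n))
  map_add' x y := Subtype.ext (funext fun n => map_add (φ n) _ _)

/-- Each *-homomorphism is contractive, and this passes to the limit of the norms. It is what lets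
the levelwise map extend to the completion. -/
theorem norm_mapThread_le (x : Thread π) : ‖mapThread φ hφ x‖ ≤ ‖x‖ :=
  le_of_tendsto_of_tendsto' (Thread.tendsto_norm' _) (Thread.tendsto_norm' x)
    fun n => NonUnitalStarAlgHom.norm_apply_le (φ n) (x.1 n)

theorem uniformContinuous_mapThread : UniformContinuous (mapThread φ hφ) :=
  (AddMonoidHomClass.lipschitz_of_bound (mapThread φ hφ) 1 fun x => by
    rw [one_mul]; exact norm_mapThread_le φ hφ x).uniformContinuous

/-- The map on completions induced by a compatible family of endomorphisms. -/
def mapFun : InductiveLimit π → InductiveLimit π := UniformSpace.Completion.map (mapThread φ hφ)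

theorem continuous_mapFun : Continuous (mapFun φ hφ) := UniformSpace.Completion.continuous_map

theorem mapFun_mk (x : Thread π) : mapFun φ hφ (mk x) = mk (mapThread φ hφ x) :=
  UniformSpace.Completion.map_coe (uniformContinuous_mapThread φ hφ) x

/-- The endomorphism of the inductive limit induced by a compatible family of endomorphisms. -/
def map : InductiveLimit π →⋆ₐ[ℂ] InductiveLimit π where
  toFun := mapFun φ hφ
  map_one' := by
    rw [← mk_one, mapFun_mk]
    exact congrArg mk (Subtype.ext (funext fun n => map_one (φ n)))
  map_zero' := by
    have : mk (0 : Thread π) = 0 := rfl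
    rw [← this, mapFun_mk, map_zero]
  map_mul' x y := by
    have hc := continuous_mapFun φ hφ
    refine denseRange_mk.induction_on₂
      (p := fun x y => mapFun φ hφ (x * y) = mapFun φ hφ x * mapFun φ hφ y)
      (isClosed_eq (hc.comp continuous_mul)
        ((hc.comp continuous_fst).mul (hc.comp continuous_snd))) (fun a b => ?_) x y
    rw [← mk_mul, mapFun_mk, mapFun_mk, mapFun_mk, ← mk_mul]
    exact congrArg mk (Subtype.ext (funext fun n => map_mul (φ n) _ _))
  map_add' x y := by
    have hc := continuous_mapFun φ hφ
    refine denseRange_mk.induction_on₂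
      (p := fun x y => mapFun φ hφ (x + y) = mapFun φ hφ x + mapFun φ hφ y)
      (isClosed_eq (hc.comp continuous_add)
        ((hc.comp continuous_fst).add (hc.comp continuous_snd))) (fun a b => ?_) x y
    rw [← mk_add, mapFun_mk, mapFun_mk, mapFun_mk, ← mk_add, map_add]
  commutes' r := by
    rw [← mk_algebraMap, mapFun_mk]
    exact congrArg mk (Subtype.ext (funext fun n => AlgHomClass.commutes (φ n) r))
  map_star' x := by
    have hc := continuous_mapFun φ hφ
    refine denseRange_mk.induction_on
      (p := fun x => mapFun φ hφ (star x) = star (mapFun φ hφ x)) x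
      (isClosed_eq (hc.comp continuous_star') (continuous_star'.comp hc)) fun a => ?_
    rw [← mk_star, mapFun_mk, mapFun_mk, ← mk_star]
    exact congrArg mk (Subtype.ext (funext fun n => map_star (φ n) _))

theorem map_of (n : ℕ) (a : A n) : map φ hφ (of π n a) = of π n (φ n a) := by
  refine (mapFun_mk φ hφ _).trans (mk_eq_mk ?_)
  filter_upwards [eventually_ge_atTop n] with m hm
  change φ m ((thread π n a).1 m) = (thread π n (φ n a)).1 m
  rw [thread_apply _ _ hm, thread_apply _ _ hm]
  induction m, hm using Nat.le_induction with
  | base => rw [trans_self, trans_self]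
  | succ m hm ih => rw [trans_succ π hm, trans_succ π hm, hφ, ih]

/-- Homomorphisms on the inductive limit that agree on all `A n` are equal. -/
theorem starAlgHom_ext {B : Type*} [CStarAlgebra B] {f g : InductiveLimit π →⋆ₐ[ℂ] B}
    (h : ∀ n a, f (of π n a) = g (of π n a)) : f = g := by
  refine StarAlgHom.ext fun x => ?_
  have hcl : IsClosed {x | f x = g x} :=
    isClosed_eq (NCTorus.continuous_starAlgHom f) (NCTorus.continuous_starAlgHom g)
  have hsub : (⋃ n, Set.range (of π n)) ⊆ {x | f x = g x} := by
    refine Set.iUnion_subset fun n => ?_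
    rintro _ ⟨a, rfl⟩
    exact h n a
  exact closure_minimal hsub hcl (dense_iUnion_range_of x)

end InductiveLimit

end CStarTower

/-! ### Gauge action along coverings, and rotation groups as `(ℤ/r)ⁿ` -/

namespace NCTorus

open CStarTower

section

variable {ι : Type} [Fintype ι]

/-- Because `s · (rk) = (rs) · k`, restricting the gauge action to the subalgebra multiplies the
parameter by `r`. -/
theorem gauge_apply_of_unit {Θ Θ' : Matrix ι ι ℝ} (r : ℕ) (φ : Torus Θ' →⋆ₐ[ℂ] Torus Θ)
    (h : ∀ k, φ (unit Θ' k) = unit Θ ((r : ℤ) • k)) (s : ι → ℝ) (a : Torus Θ') :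
    gauge Θ s (φ a) = φ (gauge Θ' ((r : ℝ) • s) a) := by
  have h1 : (gaugeHom Θ s).comp φ = φ.comp (gaugeHom Θ' ((r : ℝ) • s)) := by
    refine starAlgHom_ext fun k => ?_
    rw [StarAlgHom.comp_apply, StarAlgHom.comp_apply, h, gaugeHom_unit, gaugeHom_unit, map_smul, h,
      dotInt_smul_right, dotInt_smul_left]
    push_cast
    rfl
  exact congrArg (fun f : Torus Θ' →⋆ₐ[ℂ] Torus Θ => f a) h1

theorem phase_dotInt_frac (r : ℕ) (t k : ι → ℤ) : phase (2 * dotInt (frac r t) k) =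
    Complex.exp (2 * Real.pi * Complex.I * (∑ j, (t j : ℂ) * k j) / r) := by
  rw [dotInt_frac, phase]
  congr 1
  push_cast
  ring

omit [Fintype ι] in
theorem smul_frac_mul (q r : ℕ) [NeZero r] (t : ι → ℤ) :
    (r : ℝ) • frac (q * r) t = frac q t := by
  have hr : (r : ℝ) ≠ 0 := NeZero.ne _
  funext j
  simp only [frac, Pi.smul_apply, smul_eq_mul, Nat.cast_mul]
  field_simp

omit [Fintype ι] in
theorem frac_mul_smul (q r : ℕ) [NeZero q] (t : ι → ℤ) :
    frac (q * r) ((q : ℤ) • t) = frac r t := by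
  have hq : (q : ℝ) ≠ 0 := NeZero.ne _
  funext j
  simp only [frac, Pi.smul_apply, smul_eq_mul, Nat.cast_mul]
  push_cast
  rw [mul_div_mul_left _ _ hq]

theorem exists_equiv_range {X K : Type*} [Group X] [Group K] {ψ : X →* K}
    (h : Function.Injective ψ) : ∃ e : X ≃* ψ.range, ∀ x, (e x).1 = ψ x :=
  ⟨MonoidHom.ofInjective h, fun _ => rfl⟩

/-- Restriction of a group of automorphisms along `φ`. -/
theorem exists_restriction {X A B : Type*} [Group X] [CStarAlgebra A] [CStarAlgebra B]
    (φ : A →⋆ₐ[ℂ] B) {K : Subgroup (B ≃⋆ₐ[ℂ] B)} {H : Subgroup (A ≃⋆ₐ[ℂ] A)} (e : X ≃* K)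
    (ψ : X →* H) (hψ : Function.Surjective ψ) (h : ∀ x a, (e x).1 (φ a) = φ ((ψ x).1 a)) :
    ∃ r : K →* H, (∀ g a, g.1 (φ a) = φ ((r g).1 a)) ∧ Function.Surjective r ∧
      ∀ x, r (e x) = ψ x := by
  have hr : ∀ x, ψ.comp e.symm.toMonoidHom (e x) = ψ x := fun x =>
    congrArg ψ (e.symm_apply_apply x)
  refine ⟨ψ.comp e.symm.toMonoidHom, fun g a => ?_, fun g => ?_, hr⟩
  · obtain ⟨x, rfl⟩ := e.surjective g
    rw [h, hr]
  · obtain ⟨x, rfl⟩ := hψ g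
    exact ⟨e x, hr x⟩

/-- The group of rotations by multiples of `1 / r` is `(ℤ / r)ⁿ`. -/
theorem exists_rotations_equiv (Θ : Matrix ι ι ℝ) (r : ℕ) [NeZero r]
    {H : Subgroup (Torus Θ ≃⋆ₐ[ℂ] Torus Θ)} (hH : H = rotations Θ r) :
    ∃ f : H ≃* Multiplicative (ι → ZMod r), ∀ (t : ι → ℤ) (ht : gauge Θ (frac r t) ∈ H),
      f ⟨gauge Θ (frac r t), ht⟩ = Multiplicative.ofAdd fun j => (t j : ZMod r) := by
  subst hH
  choose t ht using fun g : rotations Θ r => (mem_rotations_iff Θ r g.1).1 g.2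
  -- The chosen vector `t g` is not additive in `g`, but its residue is independent of the choice,
  -- which makes the map below a homomorphism.
  have key : ∀ (g : rotations Θ r) (t' : ι → ℤ), g.1 = gauge Θ (frac r t') →
      ∀ j, (t g j : ZMod r) = t' j := fun g t' h =>
    (gauge_frac_eq_iff Θ r _ _).1 ((ht g).symm.trans h)
  let f : rotations Θ r →* Multiplicative (ι → ZMod r) := MonoidHom.mk'
    (fun g => Multiplicative.ofAdd fun j => (t g j : ZMod r)) fun g g' => by
      rw [← ofAdd_add]
      refine congrArg _ (funext fun j => ?_)
      rw [key (g * g') (t g + t g') (by rw [frac_add, gauge_add, ← ht, ← ht]; rfl)]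
      simp
  have hf : Function.Bijective f := by
    constructor
    · intro g g' h
      refine Subtype.ext ?_
      rw [ht g, ht g', gauge_frac_eq_iff]
      exact congrFun (Multiplicative.ofAdd.injective h)
    · intro x
      refine ⟨⟨_, gauge_frac_mem Θ r fun j => ((Multiplicative.toAdd x j).cast : ℤ)⟩, ?_⟩
      refine Multiplicative.toAdd.injective (funext fun j => ?_)
      refine (key _ _ rfl j).trans ?_
      simp
  exact ⟨MulEquiv.ofBijective f hf, fun t' ht' =>
    congrArg Multiplicative.ofAdd (funext (key ⟨_, ht'⟩ t' rfl))⟩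

end

/-! ### The tower as a finite covering sequence -/

variable (N : ℕ) (θ : ℝ) (p : ℕ → ℕ) (hp : ∀ j, 1 < p j)

include hp in
theorem neZero_prod (s : Finset ℕ) : NeZero (∏ j ∈ s, p j) :=
  ⟨Finset.prod_ne_zero_iff.2 fun j _ => (zero_lt_one.trans (hp j)).ne'⟩

include hp in
theorem neZero_mult (n : ℕ) : NeZero (mult p n) := neZero_prod p hp _

theorem towerMap_unit (n : ℕ) (x : Fin N ⊕ Fin N → ℤ) :
    towerMap N θ p hp n (unit _ x) = unit _ ((p n : ℤ) • x) := by
  have : NeZero (p n) := ⟨(zero_lt_one.trans (hp n)).ne'⟩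
  exact cover_unit (p n) (towerMatrix_succ N θ p hp n) x

theorem towerMap_injective (n : ℕ) : Function.Injective (towerMap N θ p hp n) := by
  have : NeZero (p n) := ⟨(zero_lt_one.trans (hp n)).ne'⟩
  exact cover_injective (p n) (towerMatrix_succ N θ p hp n)

theorem trans_unit {k m : ℕ} (h : k ≤ m) (x : Fin N ⊕ Fin N → ℤ) :
    trans (towerMap N θ p hp) h (unit _ x) =
      unit _ (((∏ j ∈ Finset.Ico k m, p j : ℕ) : ℤ) • x) := by
  induction m, h using Nat.le_induction with
  | base => rw [trans_self]; simp
  | succ m hm ih =>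
    rw [trans_succ _ hm, ih, towerMap_unit, Finset.prod_Ico_succ_top hm, smul_smul, mul_comm]
    push_cast
    rfl

/-- With `q = m_l/m_k` and `r = m_m/m_l`, this is `r · t/(qr) = t/q`: restriction keeps the integer
vector `t` and only changes the modulus. Invariance, restriction and surjectivity follow at once. -/
theorem gauge_trans {k l m : ℕ} (hkl : k ≤ l) (hlm : l ≤ m) (t : Fin N ⊕ Fin N → ℤ)
    (a : towerAlgebra N θ p l) :
    gauge _ (frac (∏ j ∈ Finset.Ico k m, p j) t) (trans (towerMap N θ p hp) hlm a) =
      trans (towerMap N θ p hp) hlm (gauge _ (frac (∏ j ∈ Finset.Ico k l, p j) t) a) := by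
  have := neZero_prod p hp (Finset.Ico l m)
  rw [gauge_apply_of_unit _ _ (trans_unit N θ p hp hlm), ← Finset.prod_Ico_consecutive p hkl hlm,
    smul_frac_mul]

theorem isFiniteCovering_trans {k m : ℕ} (h : k ≤ m) :
    IsFiniteCovering (trans (towerMap N θ p hp) h) (towerGroup N θ p k m) := by
  have := neZero_prod p hp (Finset.Ico k m)
  exact isFiniteCovering_of_unit _ _ (trans_injective (towerMap_injective N θ p hp) h)
    (trans_unit N θ p hp h)

include hp in
theorem towerGroup_le {k l m : ℕ} (hkl : k ≤ l) (hlm : l ≤ m) :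
    towerGroup N θ p l m ≤ towerGroup N θ p k m := by
  intro g hg
  obtain ⟨t, rfl⟩ := (mem_rotations_iff _ _ g).1 hg
  have := neZero_prod p hp (Finset.Ico k l)
  refine (mem_rotations_iff _ _ _).2 ⟨((∏ j ∈ Finset.Ico k l, p j : ℕ) : ℤ) • t, ?_⟩
  rw [← Finset.prod_Ico_consecutive p hkl hlm, frac_mul_smul]

theorem isComposable_tower : IsComposable (towerMap N θ p hp) (towerGroup N θ p) where
  covering k m h := isFiniteCovering_trans N θ p hp h.le
  invariant k l m hkl hlm g hg := by
    obtain ⟨t, rfl⟩ := (mem_rotations_iff _ _ g).1 hg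
    exact image_range_eq (gauge _ _).surjective (gauge_trans N θ p hp hkl.le hlm.le t)
  incl k l m hkl hlm := towerGroup_le N θ p hp hkl.le hlm.le
  restrict k l m hkl hlm g hg := by
    obtain ⟨t, rfl⟩ := (mem_rotations_iff _ _ g).1 hg
    exact ⟨_, gauge_frac_mem _ _ t, gauge_trans N θ p hp hkl.le hlm.le t⟩
  exact k l m hkl hlm g hg := by
    refine ⟨fun h => ?_, fun h a => ?_⟩
    · obtain ⟨t, rfl⟩ := (mem_rotations_iff _ _ g).1 hg
      have hne := neZero_prod p hp (Finset.Ico k l)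
      -- Acting trivially on `A_l` means that `t` is divisible by `m_l/m_k`; cancelling this factor
      -- shows that `g` is a rotation by multiples of `m_l/m_m`.
      have h1 : gauge (towerMatrix N θ p l) (frac (∏ j ∈ Finset.Ico k l, p j) t) = 1 := by
        refine StarAlgEquiv.ext fun a => ?_
        refine trans_injective (towerMap_injective N θ p hp) hlm.le ?_
        rw [← gauge_trans N θ p hp hkl.le hlm.le, h, StarAlgEquiv.one_apply]
      rw [gauge_eq_one_iff] at h1
      choose n hn using h1
      refine (mem_rotations_iff _ _ _).2 ⟨n, ?_⟩
      have ht : t = ((∏ j ∈ Finset.Ico k l, p j : ℕ) : ℤ) • n := by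
        funext j
        have h2 := hn j
        rw [frac, div_eq_iff (NeZero.ne _)] at h2
        rw [Pi.smul_apply, smul_eq_mul, mul_comm]
        exact_mod_cast h2
      rw [ht, ← Finset.prod_Ico_consecutive p hkl.le hlm.le, frac_mul_smul]
    · have h1 : trans (towerMap N θ p hp) hlm.le a ∈
          Set.range (trans (towerMap N θ p hp) hlm.le) := ⟨a, rfl⟩
      rw [← (isFiniteCovering_trans N θ p hp hlm.le).fixed] at h1
      exact h1 g h
  surj k l m hkl hlm g' hg' := by
    obtain ⟨t, rfl⟩ := (mem_rotations_iff _ _ g').1 hg'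
    exact ⟨_, gauge_frac_mem _ _ t, gauge_trans N θ p hp hkl.le hlm.le t⟩

theorem isFiniteCoveringSequence_tower :
    IsFiniteCoveringSequence (towerMap N θ p hp) (towerGroup N θ p) where
  toIsComposable := isComposable_tower N θ p hp
  irreducible _ := isIrreducibleRing_torus _
  separable _ := separableSpace _

/-! ### The action of `ℤ²ᴺ` on the inductive limit -/

/-- The inductive limit of the tower. -/
abbrev towerLimit : Type := InductiveLimit (towerMap N θ p hp)

/-- The parameters `z/m_n` form a compatible family, since multiplying `z/m_{n+1}` by `p_n` gives
`z/m_n`. -/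
theorem gauge_towerMap (z : Fin N ⊕ Fin N → ℤ) (n : ℕ) (a : towerAlgebra N θ p n) :
    gaugeHom _ (frac (mult p (n + 1)) z) (towerMap N θ p hp n a) =
      towerMap N θ p hp n (gaugeHom _ (frac (mult p n) z) a) := by
  have : NeZero (p n) := ⟨(zero_lt_one.trans (hp n)).ne'⟩
  refine (gauge_apply_of_unit _ _ (towerMap_unit N θ p hp n) _ a).trans ?_
  rw [mult, Finset.prod_range_succ, smul_frac_mul]
  rfl

/-- The endomorphism `U_k ↦ exp(2π i z · k / m_n) U_k` of the inductive limit. -/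
def limitGaugeHom (z : Fin N ⊕ Fin N → ℤ) : towerLimit N θ p hp →⋆ₐ[ℂ] towerLimit N θ p hp :=
  InductiveLimit.map (fun n => gaugeHom _ (frac (mult p n) z)) (gauge_towerMap N θ p hp z)

theorem limitGaugeHom_of (z : Fin N ⊕ Fin N → ℤ) (n : ℕ) (a : towerAlgebra N θ p n) :
    limitGaugeHom N θ p hp z (InductiveLimit.of _ n a) =
      InductiveLimit.of _ n (gauge _ (frac (mult p n) z) a) :=
  InductiveLimit.map_of _ (gauge_towerMap N θ p hp z) n a

theorem limitGaugeHom_comp (z z' : Fin N ⊕ Fin N → ℤ) :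
    (limitGaugeHom N θ p hp z).comp (limitGaugeHom N θ p hp z') =
      limitGaugeHom N θ p hp (z + z') := by
  refine InductiveLimit.starAlgHom_ext fun n a => ?_
  rw [StarAlgHom.comp_apply, limitGaugeHom_of, limitGaugeHom_of, limitGaugeHom_of, frac_add,
    gauge_add, StarAlgEquiv.mul_apply]

theorem limitGaugeHom_zero : limitGaugeHom N θ p hp 0 = StarAlgHom.id ℂ _ := by
  refine InductiveLimit.starAlgHom_ext fun n a => ?_
  rw [limitGaugeHom_of, show frac (mult p n) (0 : Fin N ⊕ Fin N → ℤ) = 0 by funext j; simp [frac],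
    gauge_zero]
  rfl

/-- The action of `ℤ²ᴺ` on the inductive limit. -/
def limitGauge : Multiplicative (Fin N ⊕ Fin N → ℤ) →*
    (towerLimit N θ p hp ≃⋆ₐ[ℂ] towerLimit N θ p hp) := MonoidHom.mk'
  (fun z => StarAlgEquiv.ofStarAlgHom (limitGaugeHom N θ p hp z.toAdd)
    (limitGaugeHom N θ p hp (-z.toAdd))
    (by rw [limitGaugeHom_comp, neg_add_cancel, limitGaugeHom_zero])
    (by rw [limitGaugeHom_comp, add_neg_cancel, limitGaugeHom_zero]))
  fun z z' => StarAlgEquiv.ext fun x =>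
    congrArg (fun f : towerLimit N θ p hp →⋆ₐ[ℂ] towerLimit N θ p hp => f x)
      (limitGaugeHom_comp N θ p hp z.toAdd z'.toAdd).symm

theorem limitGauge_of (z : Multiplicative (Fin N ⊕ Fin N → ℤ)) (n : ℕ)
    (a : towerAlgebra N θ p n) :
    limitGauge N θ p hp z (InductiveLimit.of _ n a) =
      InductiveLimit.of _ n (gauge _ (frac (mult p n) z.toAdd) a) :=
  limitGaugeHom_of N θ p hp z.toAdd n a

theorem of_injective (n : ℕ) :
    Function.Injective (InductiveLimit.of (towerMap N θ p hp) n) :=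
  (AddMonoidHomClass.isometry_of_norm _
    (InductiveLimit.norm_of (towerMap_injective N θ p hp) n)).injective

include hp in
theorem two_pow_le_mult (n : ℕ) : 2 ^ n ≤ mult p n := by
  rw [mult, ← Finset.card_range n, ← Finset.prod_const, Finset.card_range]
  exact Finset.prod_le_prod' fun j _ => hp j

/-- An element acting trivially on every `A_n` has all coordinates divisible by every `m_n`, and the
`m_n` are unbounded. -/
theorem limitGauge_injective : Function.Injective (limitGauge N θ p hp) := by
  rw [injective_iff_map_eq_one]
  intro z hz
  refine Multiplicative.toAdd.injective (funext fun j => ?_)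
  -- At this level `m_n ≥ 2ⁿ > n = |z_j|`, so divisibility by `m_n` forces `z_j = 0`.
  set n := (z.toAdd j).natAbs
  have := neZero_mult p hp n
  have h1 : gauge (towerMatrix N θ p n) (frac (mult p n) z.toAdd) = 1 := by
    refine StarAlgEquiv.ext fun a => of_injective N θ p hp n ?_
    rw [← limitGauge_of, hz, StarAlgEquiv.one_apply, StarAlgEquiv.one_apply]
  obtain ⟨q, hq⟩ := (gauge_eq_one_iff _ _).1 h1 j
  rw [frac, div_eq_iff (NeZero.ne _), mul_comm] at hq
  refine Int.eq_zero_of_dvd_of_natAbs_lt_natAbs (d := (mult p n : ℤ)) ⟨q, by exact_mod_cast hq⟩ ?_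
  rw [Int.natAbs_natCast]
  exact Nat.lt_two_pow_self.trans_le (two_pow_le_mult p hp n)

theorem towerGroup_zero (n : ℕ) :
    towerGroup N θ p 0 n = rotations (towerMatrix N θ p n) (mult p n) := by
  rw [towerGroup, mult, Finset.range_eq_Ico]

theorem gauge_mem_towerGroup (n : ℕ) (t : Fin N ⊕ Fin N → ℤ) :
    gauge (towerMatrix N θ p n) (frac (mult p n) t) ∈ towerGroup N θ p 0 n := by
  rw [towerGroup_zero]
  exact gauge_frac_mem _ _ t

theorem exists_of_mem_towerGroup {n : ℕ} {g : towerAlgebra N θ p n ≃⋆ₐ[ℂ] towerAlgebra N θ p n}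
    (hg : g ∈ towerGroup N θ p 0 n) : ∃ t, g = gauge (towerMatrix N θ p n) (frac (mult p n) t) := by
  rw [towerGroup_zero] at hg
  exact (mem_rotations_iff _ _ g).1 hg

theorem gauge_frac_mult_zero (z : Fin N ⊕ Fin N → ℤ) :
    gauge (towerMatrix N θ p 0) (frac (mult p 0) z) = 1 := by
  rw [gauge_eq_one_iff]
  exact fun j => ⟨z j, by simp [frac, mult]⟩

theorem of_average_mem_range (n : ℕ) (b : towerAlgebra N θ p n) :
    InductiveLimit.of (towerMap N θ p hp) n (average _ (mult p n) b) ∈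
      Set.range (InductiveLimit.of (towerMap N θ p hp) 0) := by
  have := neZero_mult p hp n
  obtain ⟨c, hc⟩ := average_mem_range _ (mult p n) (trans (towerMap N θ p hp) (Nat.zero_le n))
    (trans_injective (towerMap_injective N θ p hp) _) (fun x => ⟨unit _ x, by
      rw [trans_unit, mult, Finset.range_eq_Ico]⟩) b
  refine ⟨c, ?_⟩
  rw [← hc]
  refine InductiveLimit.mk_eq_mk ?_
  filter_upwards [eventually_ge_atTop n] with m hm
  rw [InductiveLimit.thread_apply _ _ hm, InductiveLimit.thread_apply _ _ (Nat.zero_le m),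
    trans_trans]

theorem isClosed_range_of (n : ℕ) :
    IsClosed (Set.range (InductiveLimit.of (towerMap N θ p hp) n)) :=
  (NonUnitalStarAlgHom.isometry _ (of_injective N θ p hp n)).isClosedEmbedding.isClosed_range

/-- A fixed `a` is within `ε` of some `y` in `A_n`. The average over representatives of `(ℤ/m_n)²ᴺ`
fixes `a`, sends `y` into `A_0` and is contractive, so `a` is within `ε` of the closed subalgebra
`A_0`. Conversely `m_0 = 1`, so the action on `A_0` has integer parameters and is trivial. -/
theorem limitGauge_fixed :
    {a : towerLimit N θ p hp | ∀ g ∈ (limitGauge N θ p hp).range, g a = a} =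
      Set.range (InductiveLimit.of (towerMap N θ p hp) 0) := by
  refine Set.Subset.antisymm (fun a ha => ?_) ?_
  · rw [← (isClosed_range_of N θ p hp 0).closure_eq, Metric.mem_closure_iff]
    intro ε hε
    obtain ⟨x, hx, hax⟩ := Metric.dense_iff.1
      (InductiveLimit.dense_iUnion_range_of (π := towerMap N θ p hp)) a ε hε
    obtain ⟨n, b, rfl⟩ := Set.mem_iUnion.1 hax
    refine ⟨_, of_average_mem_range N θ p hp n b, ?_⟩
    have := neZero_mult p hp n
    set r := mult p n with hr
    -- Integer representatives are needed because the limit carries an action of `ℤ²ᴺ` only; on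
    -- `A_n` they induce exactly the rotations in `average`.
    set F := fun c : Fin N ⊕ Fin N → Fin r => limitGauge N θ p hp (Multiplicative.ofAdd (lift c))
    set y := InductiveLimit.of (towerMap N θ p hp) n b
    have h1 : InductiveLimit.of (towerMap N θ p hp) n (average _ r b) =
        (Fintype.card (Fin N ⊕ Fin N → Fin r) : ℂ)⁻¹ • ∑ c, F c y := by
      rw [average_apply, map_smul, map_sum]
      congr 1
      exact Finset.sum_congr rfl fun c _ => (limitGauge_of N θ p hp _ n b).symm
    have h2 : a = (Fintype.card (Fin N ⊕ Fin N → Fin r) : ℂ)⁻¹ • ∑ c, F c a := by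
      rw [Finset.sum_congr rfl fun c _ => ha (F c) ⟨_, rfl⟩, Finset.sum_const, Finset.card_univ,
        ← Nat.cast_smul_eq_nsmul ℂ, smul_smul, inv_mul_cancel₀ (card_ne_zero r), one_smul]
    rw [h1, dist_eq_norm]
    conv_lhs => rw [h2]
    rw [← smul_sub, ← Finset.sum_sub_distrib]
    refine (norm_card_inv_smul_sum_le _ ‖a - y‖ fun c => ?_).trans_lt ?_
    · rw [← map_sub]
      exact (StarAlgEquiv.norm_map (F c) _).le
    · rwa [← dist_eq_norm, dist_comm]
  · rintro _ ⟨a, rfl⟩ g ⟨z, rfl⟩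
    rw [limitGauge_of, gauge_frac_mult_zero, StarAlgEquiv.one_apply]

theorem isRegular_tower :
    IsRegular (towerMap N θ p hp) (towerGroup N θ p) (limitGauge N θ p hp).range where
  fixed := limitGauge_fixed N θ p hp
  invariant n := by
    rintro g ⟨z, rfl⟩
    exact image_range_eq (gauge _ _).surjective (limitGauge_of N θ p hp z n)
  restrict n _ := by
    rintro g ⟨z, rfl⟩
    exact ⟨_, gauge_mem_towerGroup N θ p n _, limitGauge_of N θ p hp z n⟩
  surj n _ g' hg' := by
    obtain ⟨t, rfl⟩ := exists_of_mem_towerGroup N θ p hg'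
    exact ⟨_, ⟨Multiplicative.ofAdd t, rfl⟩, limitGauge_of N θ p hp _ n⟩

/-- The homomorphism `ℤ²ᴺ → G(A_n | A_0)`. -/
def levelGauge (n : ℕ) : Multiplicative (Fin N ⊕ Fin N → ℤ) →* towerGroup N θ p 0 n :=
  MonoidHom.mk' (fun z => ⟨gauge _ (frac (mult p n) z.toAdd), gauge_mem_towerGroup N θ p n _⟩)
    fun z z' => Subtype.ext (by
      change gauge _ (frac (mult p n) (z.toAdd + z'.toAdd)) = _
      rw [frac_add, gauge_add]
      rfl)

theorem levelGauge_surjective (n : ℕ) : Function.Surjective (levelGauge N θ p n) := by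
  rintro ⟨g, hg⟩
  obtain ⟨t, ht⟩ := exists_of_mem_towerGroup N θ p hg
  exact ⟨Multiplicative.ofAdd t, Subtype.ext ht.symm⟩

end NCTorus

end

/-! ### The main theorem -/

set_option maxHeartbeats 1000000 in
theorem mainTheorem4 (N : ℕ) (θ : ℝ) (hθ : 0 < θ) (p : ℕ → ℕ) (hp : ∀ j, 1 < p j) :
    CStarTower.IsFiniteCoveringSequence (NCTorus.towerMap N θ p hp) (NCTorus.towerGroup N θ p) ∧
    ∃ Ghat : Subgroup (CStarTower.InductiveLimit (NCTorus.towerMap N θ p hp) ≃⋆ₐ[ℂ]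
        CStarTower.InductiveLimit (NCTorus.towerMap N θ p hp)),
      CStarTower.IsRegular (NCTorus.towerMap N θ p hp) (NCTorus.towerGroup N θ p) Ghat ∧
      ∃ e : Multiplicative (Fin N ⊕ Fin N → ℤ) ≃* Ghat,
        (∀ (z : Fin N ⊕ Fin N → ℤ) (n : ℕ) (k : Fin N ⊕ Fin N → ℤ),
          (e (Multiplicative.ofAdd z)).1 (CStarTower.InductiveLimit.of _ n
              (NCTorus.unit (NCTorus.towerMatrix N θ p n) k)) =
            Complex.exp (2 * Real.pi * Complex.I * (∑ j, (z j : ℂ) * k j) / NCTorus.mult p n) •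
              CStarTower.InductiveLimit.of _ n
                (NCTorus.unit (NCTorus.towerMatrix N θ p n) k)) ∧
        ∀ n : ℕ, 0 < n →
          ∃ f : NCTorus.towerGroup N θ p 0 n ≃*
              Multiplicative (Fin N ⊕ Fin N → ZMod (NCTorus.mult p n)),
            ∃ h : Ghat →* NCTorus.towerGroup N θ p 0 n,
              (∀ (g : Ghat) (a : NCTorus.towerAlgebra N θ p n),
                g.1 (CStarTower.InductiveLimit.of _ n a) =
                  CStarTower.InductiveLimit.of _ n ((h g).1 a)) ∧
              Function.Surjective h ∧
              ∀ z : Fin N ⊕ Fin N → ℤ,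
                f (h (e (Multiplicative.ofAdd z))) =
                  Multiplicative.ofAdd fun j => (z j : ZMod (NCTorus.mult p n)) := by
  obtain ⟨e, he⟩ := NCTorus.exists_equiv_range (NCTorus.limitGauge_injective N θ p hp)
  refine ⟨NCTorus.isFiniteCoveringSequence_tower N θ p hp, (NCTorus.limitGauge N θ p hp).range,
    NCTorus.isRegular_tower N θ p hp, e, fun z n k => ?_, fun n _ => ?_⟩
  · rw [he, NCTorus.limitGauge_of, NCTorus.gauge_unit, map_smul]
    congr 1
    exact NCTorus.phase_dotInt_frac _ z k
  · have := NCTorus.neZero_mult p hp n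
    obtain ⟨f, hf⟩ := NCTorus.exists_rotations_equiv _ (NCTorus.mult p n)
      (NCTorus.towerGroup_zero N θ p n)
    -- Restriction of the automorphism of `z` is the rotation by `z/m_n`, and `f` reads off the
    -- residue of `z`; hence reduction mod `m_n`.
    obtain ⟨h, hres, hsurj, hh⟩ := NCTorus.exists_restriction _ e (NCTorus.levelGauge N θ p n)
      (NCTorus.levelGauge_surjective N θ p n) fun z a =>
        (congrArg (fun g : NCTorus.towerLimit N θ p hp ≃⋆ₐ[ℂ] NCTorus.towerLimit N θ p hp =>
          g (CStarTower.InductiveLimit.of _ n a)) (he z)).trans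
            (NCTorus.limitGauge_of N θ p hp z n a)
    exact ⟨f, h, hres, hsurj, fun z => (congrArg f (hh _)).trans (hf z _)⟩
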